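/- Let $L_1$ be the language with two sorts $O$ (objects) and $F$ (functions), a binary relation symbol $E$ and a binary function symbol $\mathrm{eval}$. Let $T_1$ be the theory saying that $O$ and $F$ are disjoint with union the universe, that $E\subseteq O^2$ is an equivalence relation on $O$, and that $\mathrm{eval}:F\times O\to O$ satisfies, for every $f\in F$ and all $b,b'\in O$: $E(\mathrm{eval}(f,b),b)$, and if $E(b,b')$ then $\mathrm{eval}(f,b)=\mathrm{eval}(f,b')$. (Formally, $O$ and $F$ are unary predicates of a one-sorted language, and $\mathrm{eval}$ is made total by putting $\mathrm{eval}(x,y)=x$ outside $F\times O$.) Let $\mathbb{K}_1$ be the class of finite models of $T_1$, the empty one included. The class $\mathbb{K}_1$ has a Fraïssé limit, i.e. there is a countable ultrahomogeneous $L_1$-structure whose age is $\mathbb{K}_1$. Let $T_1^*$ be the complete theory of a Fraïssé limit of $\mathbb{K}_1$ (any two are isomorphic). Then: 1. $T_1^*$ is NSOP$_1$: there are no formula $\varphi(x;y)$, with $x$, $y$ finite tuples of variables, and tuples $(a_\eta)_{\eta\in 2^{<\omega}}$ in a model of $T_1^*$ such that $\{\varphi(x;a_{\eta|i}):i<\omega\}$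 is consistent for all $\eta\in 2^{\omega}$, and $\{\varphi(x;a_\nu),\varphi(x;a_{\eta\frown\langle 1\rangle})\}$ is inconsistent for all $\eta,\nu\in 2^{<\omega}$ with $\nu\trianglerighteq\eta\frown\langle 0\rangle$. 2. Modulo $T_1^*$, the formula $O(x)$ axiomatizes a complete type $p(x)$ over $\emptyset$ in one variable: $O(x)\in p$, and $T_1^*\vdash O(x)\to\psi(x)$ for every $\psi\in p$. 3. The type $p$ is simple: there are no formula $\varphi(x;y)$ (with $x$ the variable of $p$ and $y$ a finite tuple), tuples $(a_\eta)_{\eta\in\omega^{<\omega}}$ in a model of $T_1^*$ and $k<\omega$ such that $\{\varphi(x;a_{\eta\frown\langle i\rangle}):i<\omega\}$ is $k$-inconsistent for all $\eta\in\omega^{<\omega}$ and $p(x)\cup\{\varphi(x;a_{\eta|i}):i<\omega\}$ is consistent for all $\eta\in\omega^{\omega}$. 4. The type $p$ is not co-simple: there are a formula $\varphi(x;y)$ (with $x$ a finite tuple and $y$ a single variable), realizations $(a_\eta)_{\eta\in\omega^{<\omega}}$ of $p$ in a model of $T_1^*$ and $k<\omega$ such that $\{\varphi(x;a_{\eta\frown\langle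 i\rangle}):i<\omega\}$ is $k$-inconsistent for all $\eta\in\omega^{<\omega}$ and $\{\varphi(x;a_{\eta|i}):i<\omega\}$ is consistent for all $\eta\in\omega^{\omega}$. Here a set of formulas with parameters in a model is consistent if each finite subset is satisfied in that model, and a family $(\varphi(x;b_i))_{i<\omega}$ is $k$-inconsistent if no $k$ members with distinct indices are satisfied together. In particular there is a simple type that is not co-simple, which answers a question of Chernikov. -/

import Mathlib

open FirstOrder FirstOrder.Language

/-! ### Combinatorial tree properties -/

namespace TreeProperties

universe u v

variable {L : FirstOrder.Language.{u, v}}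

/-- A family of sets has the finite intersection property.  For the family of solution sets, in a
structure `M`, of a family of formulas with parameters in `M`, this says that the family of formulas
is consistent (with the elementary diagram of `M`); in a monster model it says that the family,
if small, is realized. -/
def Consistent {ι X : Type*} (D : ι → Set X) : Prop :=
  ∀ s : Finset ι, (⋂ i ∈ s, D i).Nonempty

/-- Any `k` members of the family (with distinct indices) have empty intersection. -/
def KInconsistent {ι X : Type*} (k : ℕ) (D : ι → Set X) : Prop :=
  ∀ s : Finset ι, s.card = k → ¬ (⋂ i ∈ s, D i).Nonempty

/-- The solution set in `M` of the formula `φ(x; b)`. -/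
def solutions {M : Type*} [L.Structure M] {α β : Type} (φ : L.Formula (α ⊕ β)) (b : β → M) :
    Set (α → M) :=
  {x | φ.Realize (Sum.elim x b)}

/-- The restriction `η | n = ⟨η 0, …, η (n - 1)⟩` of an infinite branch `η`.
Nodes of the trees `2^{<ω}` and `ω^{<ω}` are finite lists. -/
def restrict {A : Type} (η : ℕ → A) (n : ℕ) : List A :=
  (List.range n).map η

/-- `φ(x; y)` has SOP₁ modulo `T`.  The entries `0`, `1` of the nodes are `false`, `true`. -/
def HasSOP1 (T : L.Theory) {m n : ℕ} (φ : L.Formula (Fin m ⊕ Fin n)) : Prop :=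
  ∃ (M : Theory.ModelType.{u, v, max u v} T) (a : List Bool → Fin n → M),
    (∀ η : ℕ → Bool, Consistent fun i : ℕ => solutions φ (a (restrict η i))) ∧
    ∀ η ν : List Bool, (η ++ [false]) <+: ν →
      ¬ (solutions φ (a ν) ∩ solutions φ (a (η ++ [true]))).Nonempty

/-- `T` is NSOP₁: no formula has SOP₁ modulo `T`. -/
def NSOP1 (T : L.Theory) : Prop :=
  ∀ (m n : ℕ) (φ : L.Formula (Fin m ⊕ Fin n)), ¬ HasSOP1 T φ

/-- A partial type `π(x)` over `∅` is simple: no instance of the tree property is consistent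
with `π`. -/
def IsSimpleType (T : L.Theory) {m : ℕ} (π : Set (L.Formula (Fin m))) : Prop :=
  ¬ ∃ (n : ℕ) (φ : L.Formula (Fin m ⊕ Fin n)) (k : ℕ)
      (M : Theory.ModelType.{u, v, max u v} T) (a : List ℕ → Fin n → M),
    (∀ η : List ℕ, KInconsistent k fun i : ℕ => solutions φ (a (η ++ [i]))) ∧
    ∀ η : ℕ → ℕ, Consistent (Sum.elim
      (fun ψ : π => {x : Fin m → M | ψ.1.Realize x})
      (fun i : ℕ => solutions φ (a (restrict η i))))

/-- A partial type `π` over `∅` is co-simple: the tree property is not witnessed by parameters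
realizing `π`.  Here `x` is an arbitrary finite tuple, and the variables `y` of `φ(x; y)` are
those of `π`. -/
def IsCoSimpleType (T : L.Theory) {m : ℕ} (π : Set (L.Formula (Fin m))) : Prop :=
  ¬ ∃ (n : ℕ) (φ : L.Formula (Fin n ⊕ Fin m)) (k : ℕ)
      (M : Theory.ModelType.{u, v, max u v} T) (a : List ℕ → Fin m → M),
    (∀ η : List ℕ, KInconsistent k fun i : ℕ => solutions φ (a (η ++ [i]))) ∧
    (∀ η : ℕ → ℕ, Consistent fun i : ℕ => solutions φ (a (restrict η i))) ∧
    ∀ (η : List ℕ), ∀ ψ ∈ π, ψ.Realize (a η)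

/-- The set of formulas (without parameters) belonging to a complete type over `∅`. -/
def formulasOf {T : L.Theory} {m : ℕ} (p : T.CompleteType (Fin m)) : Set (L.Formula (Fin m)) :=
  {ψ | Formula.equivSentence ψ ∈ p}

/-- Modulo `T`, the formula `θ(x)` axiomatizes (isolates) the complete type `p(x)` over `∅`. -/
def Axiomatizes (T : L.Theory) {m : ℕ} (θ : L.Formula (Fin m)) (p : T.CompleteType (Fin m)) :
    Prop :=
  θ ∈ formulasOf p ∧ ∀ ψ ∈ formulasOf p, T ⊨ᵇ θ.imp ψ

end TreeProperties

/-! ### Equivalence relations with selector functions -/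

namespace Selector

/-- The function symbols of `L₁`: one binary symbol `eval`. -/
inductive Func : ℕ → Type
  | eval : Func 2

/-- The relation symbols of `L₁`: unary `O` (objects), unary `F` (functions), binary `E`. -/
inductive Rel : ℕ → Type
  | O : Rel 1
  | F : Rel 1
  | E : Rel 2

/-- The language `L₁`, as a one-sorted language; the two sorts are unary predicates. -/
def L₁ : FirstOrder.Language.{0, 0} := ⟨Func, Rel⟩

/-- The symbol `O` of `L₁`. -/
def symO : L₁.Relations 1 := Rel.O

/-- The symbol `F` of `L₁`. -/
def symF : L₁.Relations 1 := Rel.F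

/-- The symbol `E` of `L₁`. -/
def symE : L₁.Relations 2 := Rel.E

/-- The symbol `eval` of `L₁`. -/
def symEval : L₁.Functions 2 := Func.eval

instance : Countable (Σ l, L₁.Functions l) := by
  have : Subsingleton (Σ l, L₁.Functions l) := by
    constructor
    rintro ⟨_, ⟨⟩⟩ ⟨_, ⟨⟩⟩
    rfl
  infer_instance

section Formulas

variable {α : Type} {n : ℕ}

/-- The atomic formula `O(t)`. -/
def isO (t : L₁.Term (α ⊕ Fin n)) : L₁.BoundedFormula α n :=
  Relations.boundedFormula₁ symO t

/-- The atomic formula `F(t)`. -/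
def isF (t : L₁.Term (α ⊕ Fin n)) : L₁.BoundedFormula α n :=
  Relations.boundedFormula₁ symF t

/-- The atomic formula `E(s, t)`. -/
def relE (s t : L₁.Term (α ⊕ Fin n)) : L₁.BoundedFormula α n :=
  Relations.boundedFormula₂ symE s t

/-- The term `eval(s, t)`. -/
def evalT (s t : L₁.Term (α ⊕ Fin n)) : L₁.Term (α ⊕ Fin n) :=
  Functions.apply₂ symEval s t

end Formulas

/-- The theory `T₁`.  The axioms say, in this order:
`O` and `F` are disjoint and cover the universe; `E ⊆ O²`; `E` is reflexive on `O`, symmetric,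
transitive; for `f ∈ F` and `b ∈ O`, `eval(f, b)` is `E`-equivalent to `b` (so it lies in `O`);
for `f ∈ F` and `E`-equivalent `b, b'`, `eval(f, b) = eval(f, b')`.  The last axiom is the usual
convention that makes the partial function `eval : F × O → O` total in a one-sorted language:
outside `F × O` it returns its first argument. -/
def T₁ : L₁.Theory :=
  { ∀' (isO &0 ⇔ ∼(isF &0)),
    ∀' ∀' (relE &0 &1 ⟹ (isO &0 ⊓ isO &1)),
    ∀' (isO &0 ⟹ relE &0 &0),
    ∀' ∀' (relE &0 &1 ⟹ relE &1 &0),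
    ∀' ∀' ∀' (relE &0 &1 ⟹ relE &1 &2 ⟹ relE &0 &2),
    ∀' ∀' (isF &0 ⟹ isO &1 ⟹ relE (evalT &0 &1) &1),
    ∀' ∀' ∀' (isF &0 ⟹ relE &1 &2 ⟹ (evalT &0 &1 =' evalT &0 &2)),
    ∀' ∀' (∼(isF &0 ⊓ isO &1) ⟹ (evalT &0 &1 =' &0)) }

section Semantics

variable {M : Type*} [L₁.Structure M]

/-- The interpretation of `O`. -/
def O (x : M) : Prop := Structure.RelMap symO ![x]

/-- The interpretation of `F`. -/
def F (x : M) : Prop := Structure.RelMap symF ![x]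

/-- The interpretation of `E`. -/
def E (x y : M) : Prop := Structure.RelMap symE ![x, y]

/-- The interpretation of `eval`. -/
def eval (x y : M) : M := Structure.funMap symEval ![x, y]

end Semantics

/-- The meaning of the axioms of `T₁` in a structure. -/
theorem model_T₁_iff (M : Type*) [L₁.Structure M] :
    M ⊨ T₁ ↔
      (∀ x : M, O x ↔ ¬ F x) ∧
      (∀ x y : M, E x y → O x ∧ O y) ∧
      (∀ x : M, O x → E x x) ∧
      (∀ x y : M, E x y → E y x) ∧
      (∀ x y z : M, E x y → E y z → E x z) ∧
      (∀ f b : M, F f → O b → E (eval f b) b) ∧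
      (∀ f b b' : M, F f → E b b' → eval f b = eval f b') ∧
      (∀ x y : M, ¬ (F x ∧ O y) → eval x y = x) := by
  simp [T₁, isO, isF, relE, evalT, O, F, E, eval, Sentence.Realize, Formula.Realize,
    BoundedFormula.realize_rel₁, BoundedFormula.realize_rel₂, Fin.snoc]

/-- The class `𝕂₁` of finite models of `T₁`. -/
def K₁ : Set (CategoryTheory.Bundled.{0} L₁.Structure) :=
  {M | Finite M ∧ M ⊨ T₁}

/-- The formula `O(x)` in one free variable. -/
def formulaO : L₁.Formula (Fin 1) :=
  isO (Term.var (Sum.inl 0))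

end Selector

/-!
The Fraïssé limit of `𝕂₁` is realized concretely: objects are pairs of a class `κ` and an index in
it, functions are natural numbers, and the value of the function `f` on the class `κ` is the object
with index `r f κ`, where `r` is generic.  Since each function chooses one point of each class,
independently of its other choices, finite partial isomorphisms extend back and forth.  So types
are determined by the isomorphism type of the finite substructure generated by a tuple, and the
theory is `ℵ₀`-categorical, which moves the tree properties into the concrete model.

NSOP₁: along a long branch of a tree, a finite tuple meets the generated substructure of some node
only in points and classes that it already shares with earlier nodes, so that it is independent
from that node.  Two tuples of the same type, each independent from its node over a common base,
have a common amalgam, which realizes a formula that SOP₁ would make inconsistent.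

Simplicity of `O(x)`: passing to a Δ-system among the siblings below a node shows that, if they are
`k`-inconsistent, then some sibling forces an object satisfying its formula either into a class or
to be a point that did not occur before.  An object first meets its class and then is met itself,
so this happens at most twice along a branch.

Failure of co-simplicity: no function selects two objects of the same class, while finitely many
objects in distinct classes are selected by a common function.
-/

namespace TreeProperties

theorem restrict_getD {A : Type} (d : A) {μ ν : List A} (h : μ <+: ν) :
    restrict (fun i => ν.getD i d) μ.length = μ := by
  obtain ⟨t, rfl⟩ := h
  refine List.ext_getElem (by simp [restrict]) fun i _ hi => ?_
  simp [restrict, List.getElem?_append_left hi, hi]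

theorem exists_mem_of_prefix {A X : Type} (d : A) {D : List A → Set X}
    (h : ∀ η : ℕ → A, Consistent fun i : ℕ => D (restrict η i)) (ν : List A) :
    ∃ x, ∀ μ, μ <+: ν → x ∈ D μ := by
  obtain ⟨x, hx⟩ := h (fun i => ν.getD i d) (Finset.range (ν.length + 1))
  refine ⟨x, fun μ hμ => restrict_getD d hμ ▸ ?_⟩
  exact Set.mem_iInter₂.1 hx μ.length (Finset.mem_range.2 (Nat.lt_succ_of_le hμ.length_le))

theorem comp_mem_solutions_iff {L : FirstOrder.Language} {M N : Type*} [L.Structure M]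
    [L.Structure N] (g : M ↪ₑ[L] N) {α β : Type} {φ : L.Formula (α ⊕ β)} {x : α → M} {b : β → M} :
    g ∘ x ∈ solutions φ (g ∘ b) ↔ x ∈ solutions φ b := by
  simp only [solutions, Set.mem_ofPred_eq, ← Sum.comp_elim]
  exact g.map_formula φ (Sum.elim x b)

theorem KInconsistent.preimage {ι X Y : Type*} {k : ℕ} {D : ι → Set Y} (hD : KInconsistent k D)
    (g : X → Y) : KInconsistent k fun i => g ⁻¹' D i :=
  fun s hs ⟨x, hx⟩ => hD s hs ⟨g x, by simpa using hx⟩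

end TreeProperties

namespace Selector

/-! ### The models `Pt r` -/

section Model

open Equiv

section BackAndForth

variable {L : FirstOrder.Language} {M N : Type*} [L.Structure M] [L.Structure N] {α : Type*}

theorem realize_iff_of_backAndForth {v : α → M} {w : α → N}
    {R : ∀ n, (Fin n → M) → (Fin n → N) → Prop}
    (atomic : ∀ {n xs ys}, R n xs ys → ∀ φ : L.BoundedFormula α n, φ.IsAtomic →
      (φ.Realize v xs ↔ φ.Realize w ys))
    (forth : ∀ {n xs ys}, R n xs ys → ∀ x, ∃ y, R (n + 1) (Fin.snoc xs x) (Fin.snoc ys y))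
    (back : ∀ {n xs ys}, R n xs ys → ∀ y, ∃ x, R (n + 1) (Fin.snoc xs x) (Fin.snoc ys y))
    {n : ℕ} (φ : L.BoundedFormula α n) {xs : Fin n → M} {ys : Fin n → N} (h : R n xs ys) :
    φ.Realize v xs ↔ φ.Realize w ys := by
  induction φ with
  | falsum => rfl
  | equal t₁ t₂ => exact atomic h _ (.equal t₁ t₂)
  | rel S ts => exact atomic h _ (.rel S ts)
  | imp φ ψ ihφ ihψ => simp only [BoundedFormula.realize_imp, ihφ h, ihψ h]
  | all φ ih =>
    simp only [BoundedFormula.realize_all]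
    constructor
    · intro hφ y
      obtain ⟨x, hx⟩ := back h y
      exact (ih hx).1 (hφ x)
    · intro hφ x
      obtain ⟨y, hy⟩ := forth h x
      exact (ih hy).2 (hφ y)

end BackAndForth

/-- The model of `T₁` whose functions and classes are indexed by `ℕ`, each class being enumerated
by `ℕ`, in which the function `f` selects the element `r f κ` of the class `κ`. -/
inductive Pt (r : ℕ → ℕ → ℕ) : Type
  | obj (κ n : ℕ) : Pt r
  | fn (f : ℕ) : Pt r

namespace Pt

variable {r r' : ℕ → ℕ → ℕ}

/-- The function `eval` of `Pt r`. -/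
def evalFun : Pt r → Pt r → Pt r
  | fn f, obj κ _ => obj κ (r f κ)
  | x, _ => x

/-- The predicate `O` of `Pt r`. -/
def IsObj : Pt r → Prop
  | obj _ _ => True
  | fn _ => False

/-- The relation `E` of `Pt r`. -/
def SameClass : Pt r → Pt r → Prop
  | obj κ _, obj κ' _ => κ = κ'
  | _, _ => False

instance : L₁.Structure (Pt r) where
  funMap {n} (f : Func n) v := match n, f, v with
    | _, Func.eval, v => evalFun (v 0) (v 1)
  RelMap {n} (R : Rel n) v := match n, R, v with
    | _, Rel.O, v => IsObj (v 0)
    | _, Rel.F, v => ¬ IsObj (v 0)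
    | _, Rel.E, v => SameClass (v 0) (v 1)

@[simp] theorem O_obj (κ n : ℕ) : O (obj κ n : Pt r) := trivial
@[simp] theorem not_O_fn (f : ℕ) : ¬ O (fn f : Pt r) := id
@[simp] theorem F_fn (f : ℕ) : F (fn f : Pt r) := id
@[simp] theorem not_F_obj (κ n : ℕ) : ¬ F (obj κ n : Pt r) := fun h => h trivial
@[simp] theorem E_obj_obj (κ n κ' n' : ℕ) : E (obj κ n : Pt r) (obj κ' n') ↔ κ = κ' := Iff.rfl
@[simp] theorem not_E_fn_left (f : ℕ) (x : Pt r) : ¬ E (fn f) x := id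
@[simp] theorem not_E_fn_right (f : ℕ) (x : Pt r) : ¬ E x (fn f) := by
  cases x <;> exact id
@[simp] theorem eval_fn_obj (f κ n : ℕ) : eval (fn f : Pt r) (obj κ n) = obj κ (r f κ) := rfl
@[simp] theorem eval_fn_fn (f g : ℕ) : eval (fn f : Pt r) (fn g) = fn f := rfl
@[simp] theorem eval_obj (κ n : ℕ) (x : Pt r) : eval (obj κ n : Pt r) x = obj κ n := by
  cases x <;> rfl

theorem exists_eq_obj {x : Pt r} (hx : O x) : ∃ κ n, x = obj κ n := by
  cases x <;> simp_all

instance : Nonempty (Pt r) := ⟨fn 0⟩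

instance : Infinite (Pt r) := Infinite.of_injective fn fun _ _ h => by injection h

instance : Countable (Pt r) := by
  have : Function.Injective (fun x : Pt r => match x with
      | obj κ n => (Sum.inl (κ, n) : (ℕ × ℕ) ⊕ ℕ)
      | fn f => Sum.inr f) := by
    rintro (⟨κ, n⟩ | f) (⟨κ', n'⟩ | f') h <;> simp_all
  exact this.countable

theorem model_T₁ (r : ℕ → ℕ → ℕ) : Pt r ⊨ T₁ := by
  rw [model_T₁_iff]
  refine ⟨?_, ?_, ?_, ?_, ?_, ?_, ?_, ?_⟩
  · rintro (_ | _) <;> simp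
  · rintro (_ | _) (_ | _) <;> simp
  · rintro (_ | _) <;> simp
  · rintro (_ | _) (_ | _) <;> simp [eq_comm]
  · rintro (_ | _) (_ | _) (_ | _) <;> simp +contextual
  · rintro (_ | _) (_ | _) <;> simp
  · rintro (_ | _) (_ | _) (_ | _) <;> simp +contextual
  · rintro (_ | _) (_ | _) <;> simp

end Pt

/-- The property of `r` that makes `Pt r` the Fraïssé limit: finitely many values of a new function
can be prescribed, and so can, up to a permutation of the class, finitely many values on a new
class. -/
structure Generic (r : ℕ → ℕ → ℕ) : Prop where
  exists_fn : ∀ {Φ K : Set ℕ}, Φ.Finite → K.Finite → ∀ v : ℕ → ℕ,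
    ∃ f ∉ Φ, ∀ κ ∈ K, r f κ = v κ
  exists_class : ∀ {Φ K : Set ℕ}, Φ.Finite → K.Finite → ∀ v : ℕ → ℕ,
    ∃ κ ∉ K, ∃ g : Perm ℕ, ∀ f ∈ Φ, r f κ = g (v f)

/-! ### Finite partial isomorphisms -/

/-- An isomorphism of the reducts of `Pt r` and `Pt r'` to `O`, `F` and `E`, given by its action on
the indices; these reducts do not depend on `r` and `r'`. -/
structure ReductIso where
  /-- the bijection of the functions -/
  σ : Perm ℕ
  /-- the bijection of the classes -/
  τ : Perm ℕ
  /-- the bijection of the class `κ` with the class `τ κ` -/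
  h : ℕ → Perm ℕ

namespace ReductIso

open Pt

variable {r r' : ℕ → ℕ → ℕ}

/-- The inverse isomorphism. -/
def symm (A : ReductIso) : ReductIso :=
  ⟨A.σ.symm, A.τ.symm, fun κ => (A.h (A.τ.symm κ)).symm⟩

/-- The underlying bijection. -/
def toEquiv (A : ReductIso) : Pt r ≃ Pt r' where
  toFun
    | obj κ n => obj (A.τ κ) (A.h κ n)
    | fn f => fn (A.σ f)
  invFun
    | obj κ n => obj (A.τ.symm κ) ((A.h (A.τ.symm κ)).symm n)
    | fn f => fn (A.σ.symm f)
  left_inv := by rintro (_ | _) <;> simp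
  right_inv := by rintro (_ | _) <;> simp

@[simp] theorem toEquiv_obj (A : ReductIso) (κ n : ℕ) :
    A.toEquiv (obj κ n : Pt r) = (obj (A.τ κ) (A.h κ n) : Pt r') := rfl
@[simp] theorem toEquiv_fn (A : ReductIso) (f : ℕ) :
    A.toEquiv (fn f : Pt r) = (fn (A.σ f) : Pt r') := rfl

theorem toEquiv_symm (A : ReductIso) : (A.symm.toEquiv : Pt r' ≃ Pt r) = A.toEquiv.symm := by
  ext (_ | _) <;> rfl

theorem O_toEquiv (A : ReductIso) (x : Pt r) : O (A.toEquiv x : Pt r') ↔ O x := by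
  cases x <;> simp

theorem F_toEquiv (A : ReductIso) (x : Pt r) : F (A.toEquiv x : Pt r') ↔ F x := by
  cases x <;> simp

theorem E_toEquiv (A : ReductIso) (x y : Pt r) :
    E (A.toEquiv x : Pt r') (A.toEquiv y) ↔ E x y := by
  cases x <;> cases y <;> simp

end ReductIso

/-- An isomorphism between finitely generated substructures of `Pt r` and `Pt r'`, the first
consisting of the functions in `fns` and of all objects of the classes in `classes`.  It is encoded
as a total isomorphism of reducts that respects `eval` on this substructure. -/
structure PartialIso (r r' : ℕ → ℕ → ℕ) extends ReductIso where
  /-- the functions in the domain -/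
  fns : Set ℕ
  /-- the classes in the domain -/
  classes : Set ℕ
  finite_fns : fns.Finite
  finite_classes : classes.Finite
  map_value : ∀ f ∈ fns, ∀ κ ∈ classes, r' (σ f) (τ κ) = h κ (r f κ)

namespace PartialIso

open Pt

variable {r r' : ℕ → ℕ → ℕ}

instance : CoeFun (PartialIso r r') fun _ => Pt r → Pt r' := ⟨fun A => A.toEquiv⟩

/-- The domain of a partial isomorphism. -/
def dom (A : PartialIso r r') : Set (Pt r) :=
  {x | match x with
    | obj κ _ => κ ∈ A.classes
    | fn f => f ∈ A.fns}

@[simp] theorem obj_mem_dom {A : PartialIso r r'} {κ n : ℕ} : obj κ n ∈ A.dom ↔ κ ∈ A.classes :=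
  Iff.rfl
@[simp] theorem fn_mem_dom {A : PartialIso r r'} {f : ℕ} : fn f ∈ A.dom ↔ f ∈ A.fns := Iff.rfl

theorem eval_mem_dom (A : PartialIso r r') {x y : Pt r} (hx : x ∈ A.dom) (hy : y ∈ A.dom) :
    eval x y ∈ A.dom := by
  cases x <;> cases y <;> simp_all

theorem map_eval (A : PartialIso r r') {x y : Pt r} (hx : x ∈ A.dom) (hy : y ∈ A.dom) :
    A (eval x y) = eval (A x) (A y) := by
  cases x <;> cases y <;>
    simp only [eval_obj, eval_fn_fn, eval_fn_obj, ReductIso.toEquiv_obj, ReductIso.toEquiv_fn]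
  rw [A.map_value _ hx _ hy]

/-- Extension of partial isomorphisms; only the values on the domains are compared. -/
instance : Preorder (PartialIso r r') where
  le A B := A.dom ⊆ B.dom ∧ Set.EqOn B A A.dom
  le_refl A := ⟨subset_rfl, fun _ _ => rfl⟩
  le_trans A B C hAB hBC :=
    ⟨hAB.1.trans hBC.1, fun _ hx => (hBC.2 (hAB.1 hx)).trans (hAB.2 hx)⟩

/-- The inverse partial isomorphism. -/
def symm (A : PartialIso r r') : PartialIso r' r where
  toReductIso := A.toReductIso.symm
  fns := A.σ '' A.fns
  classes := A.τ '' A.classes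
  finite_fns := A.finite_fns.image _
  finite_classes := A.finite_classes.image _
  map_value := by
    rintro _ ⟨f, hf, rfl⟩ _ ⟨κ, hκ, rfl⟩
    simp [ReductIso.symm, A.map_value f hf κ hκ]

@[simp] theorem symm_apply_apply (A : PartialIso r r') (x : Pt r) : A.symm (A x) = x := by
  change A.toReductIso.symm.toEquiv _ = x
  rw [ReductIso.toEquiv_symm, Equiv.symm_apply_apply]

theorem apply_mem_dom_symm {A : PartialIso r r'} {x : Pt r} (hx : x ∈ A.dom) :
    A x ∈ A.symm.dom := by
  cases x
  · exact Set.mem_image_of_mem A.τ hx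
  · exact Set.mem_image_of_mem A.σ hx

/-- The tuple `v` lies in the domain of `A`, which maps it to `w`. -/
def Maps {β : Type*} (A : PartialIso r r') (v : β → Pt r) (w : β → Pt r') : Prop :=
  ∀ b, v b ∈ A.dom ∧ A (v b) = w b

namespace Maps

variable {β γ : Type*} {A B : PartialIso r r'} {v : β → Pt r} {w : β → Pt r'}

theorem mono (h : A.Maps v w) (hAB : A ≤ B) : B.Maps v w :=
  fun b => ⟨hAB.1 (h b).1, (hAB.2 (h b).1).trans (h b).2⟩

theorem symm (h : A.Maps v w) : A.symm.Maps w v := fun b => by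
  rw [← (h b).2]
  exact ⟨apply_mem_dom_symm (h b).1, A.symm_apply_apply _⟩

theorem snoc {n : ℕ} {xs : Fin n → Pt r} {ys : Fin n → Pt r'} (h : A.Maps xs ys) {x : Pt r}
    (hx : x ∈ A.dom) : A.Maps (Fin.snoc xs x) (Fin.snoc ys (A x)) := fun i => by
  refine Fin.lastCases ?_ (fun i => ?_) i
  · simpa using hx
  · simpa using h i

theorem elim {xs : γ → Pt r} {ys : γ → Pt r'} (h : A.Maps v w) (h' : A.Maps xs ys) :
    A.Maps (Sum.elim v xs) (Sum.elim w ys) := by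
  rintro (b | c)
  exacts [h b, h' c]

theorem realize_term (h : A.Maps v w) (t : L₁.Term β) :
    t.realize v ∈ A.dom ∧ A (t.realize v) = t.realize w := by
  induction t with
  | var b => exact h b
  | func f ts ih =>
    obtain ⟨⟩ := f
    change eval ((ts 0).realize v) ((ts 1).realize v) ∈ A.dom ∧
      A (eval ((ts 0).realize v) ((ts 1).realize v)) = eval ((ts 0).realize w) ((ts 1).realize w)
    rw [← (ih 0).2, ← (ih 1).2]
    exact ⟨A.eval_mem_dom (ih 0).1 (ih 1).1, A.map_eval (ih 0).1 (ih 1).1⟩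

theorem realize_iff_of_isAtomic {n : ℕ} {xs : Fin n → Pt r} {ys : Fin n → Pt r'}
    (h : A.Maps (Sum.elim v xs) (Sum.elim w ys)) {φ : L₁.BoundedFormula β n} (hφ : φ.IsAtomic) :
    φ.Realize v xs ↔ φ.Realize w ys := by
  obtain ⟨t₁, t₂⟩ | ⟨R, ts⟩ := hφ
  · simp only [BoundedFormula.realize_bdEqual, ← (h.realize_term t₁).2, ← (h.realize_term t₂).2,
      A.toEquiv.injective.eq_iff]
  · simp only [BoundedFormula.realize_rel, ← (h.realize_term (ts _)).2]
    obtain ⟨⟩ | ⟨⟩ | ⟨⟩ := R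
    · exact (A.O_toEquiv _).symm
    · exact (A.F_toEquiv _).symm
    · exact (A.E_toEquiv _ _).symm

end Maps

/-- Extension of a partial isomorphism to the class `κ`, mapped to the class `κ'` by `g`. -/
def adjoinClass (A : PartialIso r r') (κ κ' : ℕ) (g : Perm ℕ) (hκ : κ ∉ A.classes)
    (hκ' : κ' ∉ A.τ '' A.classes) (hg : ∀ f ∈ A.fns, r' (A.σ f) κ' = g (r f κ)) :
    PartialIso r r' where
  σ := A.σ
  τ := A.τ.trans (swap (A.τ κ) κ')
  h := Function.update A.h κ g
  fns := A.fns
  classes := insert κ A.classes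
  finite_fns := A.finite_fns
  finite_classes := A.finite_classes.insert κ
  map_value := by
    rintro f hf i (rfl | hi)
    · simpa using hg f hf
    · have hne : i ≠ κ := ne_of_mem_of_not_mem hi hκ
      rw [trans_apply, swap_apply_of_ne_of_ne (A.τ.injective.ne hne)
        (ne_of_mem_of_not_mem (Set.mem_image_of_mem _ hi) hκ'), Function.update_of_ne hne]
      exact A.map_value f hf i hi

section AdjoinClass

variable {A : PartialIso r r'} {κ κ' : ℕ} {g : Perm ℕ} (hκ : κ ∉ A.classes)
  (hκ' : κ' ∉ A.τ '' A.classes) (hg : ∀ f ∈ A.fns, r' (A.σ f) κ' = g (r f κ))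

theorem adjoinClass_apply_self (n : ℕ) :
    A.adjoinClass κ κ' g hκ hκ' hg (obj κ n) = obj κ' (g n) := by
  simp [adjoinClass]

theorem le_adjoinClass : A ≤ A.adjoinClass κ κ' g hκ hκ' hg := by
  refine ⟨?_, ?_⟩
  · rintro (_ | _) hx
    exacts [Set.mem_insert_of_mem κ hx, hx]
  · rintro (⟨i, n⟩ | f) hx
    · have hne : i ≠ κ := ne_of_mem_of_not_mem hx hκ
      simp [adjoinClass, hne, swap_apply_of_ne_of_ne (A.τ.injective.ne hne)
        (ne_of_mem_of_not_mem (Set.mem_image_of_mem _ hx) hκ')]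
    · rfl

end AdjoinClass

/-- Extension of a partial isomorphism to the function `f`, mapped to the function `f'`. -/
def adjoinFn (A : PartialIso r r') (f f' : ℕ) (hf : f ∉ A.fns) (hf' : f' ∉ A.σ '' A.fns)
    (hv : ∀ κ ∈ A.classes, r' f' (A.τ κ) = A.h κ (r f κ)) : PartialIso r r' where
  σ := A.σ.trans (swap (A.σ f) f')
  τ := A.τ
  h := A.h
  fns := insert f A.fns
  classes := A.classes
  finite_fns := A.finite_fns.insert f
  finite_classes := A.finite_classes
  map_value := by
    rintro i (rfl | hi) κ hκ
    · simpa using hv κ hκ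
    · rw [trans_apply, swap_apply_of_ne_of_ne (A.σ.injective.ne (ne_of_mem_of_not_mem hi hf))
        (ne_of_mem_of_not_mem (Set.mem_image_of_mem _ hi) hf')]
      exact A.map_value i hi κ hκ

section AdjoinFn

variable {A : PartialIso r r'} {f f' : ℕ} (hf : f ∉ A.fns) (hf' : f' ∉ A.σ '' A.fns)
  (hv : ∀ κ ∈ A.classes, r' f' (A.τ κ) = A.h κ (r f κ))

theorem adjoinFn_apply_self : A.adjoinFn f f' hf hf' hv (fn f) = fn f' := by
  simp [adjoinFn]

theorem le_adjoinFn : A ≤ A.adjoinFn f f' hf hf' hv := by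
  refine ⟨?_, ?_⟩
  · rintro (_ | _) hx
    exacts [hx, Set.mem_insert_of_mem f hx]
  · rintro (_ | i) hx
    · rfl
    · simp [adjoinFn, swap_apply_of_ne_of_ne (A.σ.injective.ne (ne_of_mem_of_not_mem hx hf))
        (ne_of_mem_of_not_mem (Set.mem_image_of_mem _ hx) hf')]

end AdjoinFn

end PartialIso

theorem exists_factor {ι : Sort*} {p q : ι → ℕ} (h : ∀ i j, p i = p j → q i = q j) :
    ∃ v : ℕ → ℕ, ∀ i, v (p i) = q i :=
  have hf : q.FactorsThrough p := fun i j => h i j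
  ⟨Function.extend p q 0, fun i => hf.extend_apply 0 i⟩

namespace Generic

variable {r r' : ℕ → ℕ → ℕ} {S : Type*} [Finite S]

theorem exists_common_class (hr' : Generic r') (A : S → PartialIso r r') (κ : ℕ)
    (hA : ∀ s, ∀ f ∈ (A s).fns, ∀ s', ∀ f' ∈ (A s').fns, (A s).σ f = (A s').σ f' →
      r f κ = r f' κ) :
    ∃ (κ' : ℕ) (g : Perm ℕ), ∀ s, κ' ∉ (A s).τ '' (A s).classes ∧
      ∀ f ∈ (A s).fns, r' ((A s).σ f) κ' = g (r f κ) := by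
  obtain ⟨v, hv⟩ := exists_factor (ι := Σ s, (A s).fns) (p := fun i => (A i.1).σ i.2)
    (q := fun i => r i.2 κ) fun i j => hA i.1 i.2 i.2.2 j.1 j.2 j.2.2
  obtain ⟨κ', hκ', g, hg⟩ := hr'.exists_class
    (Set.finite_iUnion fun s => (A s).finite_fns.image (A s).σ)
    (Set.finite_iUnion fun s => (A s).finite_classes.image (A s).τ) v
  rw [Set.mem_iUnion, not_exists] at hκ'
  refine ⟨κ', g, fun s => ⟨hκ' s, fun f hf => ?_⟩⟩
  rw [hg _ (Set.mem_iUnion.2 ⟨s, f, hf, rfl⟩), hv ⟨s, f, hf⟩]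

theorem exists_common_fn (hr' : Generic r') (A : S → PartialIso r r') (f : ℕ)
    (hA : ∀ s, ∀ κ ∈ (A s).classes, ∀ s', ∀ κ' ∈ (A s').classes, (A s).τ κ = (A s').τ κ' →
      (A s).h κ (r f κ) = (A s').h κ' (r f κ')) :
    ∃ f', ∀ s, f' ∉ (A s).σ '' (A s).fns ∧
      ∀ κ ∈ (A s).classes, r' f' ((A s).τ κ) = (A s).h κ (r f κ) := by
  obtain ⟨v, hv⟩ := exists_factor (ι := Σ s, (A s).classes) (p := fun i => (A i.1).τ i.2)
    (q := fun i => (A i.1).h i.2 (r f i.2)) fun i j => hA i.1 i.2 i.2.2 j.1 j.2 j.2.2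
  obtain ⟨f', hf', hfv⟩ := hr'.exists_fn
    (Set.finite_iUnion fun s => (A s).finite_fns.image (A s).σ)
    (Set.finite_iUnion fun s => (A s).finite_classes.image (A s).τ) v
  rw [Set.mem_iUnion, not_exists] at hf'
  refine ⟨f', fun s => ⟨hf' s, fun κ hκ => ?_⟩⟩
  rw [hfv _ (Set.mem_iUnion.2 ⟨s, κ, hκ, rfl⟩), hv ⟨s, κ, hκ⟩]

end Generic

namespace PartialIso

variable {r r' : ℕ → ℕ → ℕ}

theorem exists_extend (hr' : Generic r') (A : PartialIso r r') (x : Pt r) :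
    ∃ B, A ≤ B ∧ x ∈ B.dom := by
  by_cases hx : x ∈ A.dom
  · exact ⟨A, le_rfl, hx⟩
  rcases x with ⟨κ, n⟩ | f
  · obtain ⟨κ', g, hg⟩ := hr'.exists_common_class (fun _ : Unit => A) κ
      (fun _ f _ _ f' _ h => by rw [A.σ.injective h])
    exact ⟨_, le_adjoinClass hx (hg ()).1 (hg ()).2, Set.mem_insert κ _⟩
  · obtain ⟨f', hf'⟩ := hr'.exists_common_fn (fun _ : Unit => A) f
      (fun _ κ _ _ κ' _ h => by rw [A.τ.injective h])
    exact ⟨_, le_adjoinFn hx (hf' ()).1 (hf' ()).2, Set.mem_insert f _⟩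

theorem exists_extend_finite (hr' : Generic r') (A : PartialIso r r') {X : Set (Pt r)}
    (hX : X.Finite) : ∃ B, A ≤ B ∧ X ⊆ B.dom := by
  induction X, hX using Set.Finite.induction_on with
  | empty => exact ⟨A, le_rfl, Set.empty_subset _⟩
  | @insert x X _ _ ih =>
    obtain ⟨B, hAB, hB⟩ := ih
    obtain ⟨C, hBC, hC⟩ := B.exists_extend hr' x
    exact ⟨C, hAB.trans hBC, Set.insert_subset hC (hB.trans hBC.1)⟩

theorem Maps.realize_iff (hr : Generic r) (hr' : Generic r') {β : Type*} {A : PartialIso r r'}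
    {v : β → Pt r} {w : β → Pt r'} (h : A.Maps v w) (φ : L₁.Formula β) :
    φ.Realize v ↔ φ.Realize w := by
  refine realize_iff_of_backAndForth
    (R := fun _ xs ys => ∃ B : PartialIso r r', B.Maps v w ∧ B.Maps xs ys)
    ?_ ?_ ?_ φ ⟨A, h, fun i => i.elim0⟩
  · rintro n xs ys ⟨B, hB, hB'⟩ φ hφ
    exact (hB.elim hB').realize_iff_of_isAtomic hφ
  · rintro n xs ys ⟨B, hB, hB'⟩ x
    obtain ⟨C, hBC, hx⟩ := B.exists_extend hr' x
    exact ⟨_, C, hB.mono hBC, (hB'.mono hBC).snoc hx⟩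
  · rintro n xs ys ⟨B, hB, hB'⟩ y
    obtain ⟨C, hBC, hy⟩ := B.symm.exists_extend hr y
    exact ⟨_, C.symm, (hB.symm.mono hBC).symm,
      by simpa using ((hB'.symm.mono hBC).snoc hy).symm⟩

end PartialIso

end Model

/-! ### Atomic types -/

section AtomicTypes

open Equiv

theorem comp_eq_vec₁ {M N : Type*} (g : M → N) (v : Fin 1 → M) : g ∘ v = ![g (v 0)] :=
  List.ofFn_inj.1 rfl

theorem comp_eq_vec₂ {M N : Type*} (g : M → N) (v : Fin 2 → M) : g ∘ v = ![g (v 0), g (v 1)] :=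
  List.ofFn_inj.1 rfl

section Embedding

variable {M N : Type*} [L₁.Structure M] [L₁.Structure N]

theorem O_map_embedding (g : M ↪[L₁] N) (x : M) : O (g x) ↔ O x := by
  rw [O, O, ← g.map_rel, comp_eq_vec₁]
  rfl

theorem F_map_embedding (g : M ↪[L₁] N) (x : M) : F (g x) ↔ F x := by
  rw [F, F, ← g.map_rel, comp_eq_vec₁]
  rfl

theorem E_map_embedding (g : M ↪[L₁] N) (x y : M) : E (g x) (g y) ↔ E x y := by
  rw [E, E, ← g.map_rel, comp_eq_vec₂]
  rfl

theorem eval_map_embedding (g : M ↪[L₁] N) (x y : M) : eval (g x) (g y) = g (eval x y) := by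
  rw [eval, eval, g.map_fun, comp_eq_vec₂]
  rfl

theorem model_T₁_of_embedding (g : M ↪[L₁] N) (h : N ⊨ T₁) : M ⊨ T₁ := by
  rw [model_T₁_iff] at h ⊢
  obtain ⟨h1, h2, h3, h4, h5, h6, h7, h8⟩ := h
  simp only [← O_map_embedding g, ← F_map_embedding g, ← E_map_embedding g,
    ← g.injective.eq_iff, ← eval_map_embedding g]
  exact ⟨fun _ => h1 _, fun _ _ => h2 _ _, fun _ => h3 _, fun _ _ => h4 _ _, fun _ _ _ => h5 _ _ _,
    fun _ _ => h6 _ _, fun _ _ _ => h7 _ _ _, fun _ _ => h8 _ _⟩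

/-- Bundles an injective map that preserves `O`, `F`, `E` and `eval` as an embedding. -/
def mkEmbedding (g : M → N) (hg : Function.Injective g) (hO : ∀ x, O (g x) ↔ O x)
    (hF : ∀ x, F (g x) ↔ F x) (hE : ∀ x y, E (g x) (g y) ↔ E x y)
    (hev : ∀ x y, g (eval x y) = eval (g x) (g y)) : M ↪[L₁] N where
  toFun := g
  inj' := hg
  map_fun' := by
    rintro n ⟨⟩ v
    rw [comp_eq_vec₂, ← Function.id_comp v, comp_eq_vec₂]
    exact hev _ _
  map_rel' := by
    rintro n (_ | _ | _) v
    · rw [comp_eq_vec₁, ← Function.id_comp v, comp_eq_vec₁]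
      exact hO _
    · rw [comp_eq_vec₁, ← Function.id_comp v, comp_eq_vec₁]
      exact hF _
    · rw [comp_eq_vec₂, ← Function.id_comp v, comp_eq_vec₂]
      exact hE _ _

end Embedding

section AtomicType

variable {M N : Type*} [L₁.Structure M] [L₁.Structure N] {ι : Type*}

/-- The quantifier-free type of a tuple in a model of `T₁`.  The equality of two entries of the
tuple is recorded through `eval x x = x`. -/
def atomicType (u : ι → M) : (ι → Prop) × (ι → ι → Prop) × (ι → ι → ι → ι → Prop) :=
  (fun i => F (u i), fun i j => E (u i) (u j),
    fun i j k l => eval (u i) (u j) = eval (u k) (u l))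

theorem atomicType_eq_iff {u : ι → M} {v : ι → N} :
    atomicType u = atomicType v ↔ (∀ i, F (u i) ↔ F (v i)) ∧
      (∀ i j, E (u i) (u j) ↔ E (v i) (v j)) ∧
      ∀ i j k l, eval (u i) (u j) = eval (u k) (u l) ↔ eval (v i) (v j) = eval (v k) (v l) := by
  simp only [atomicType, Prod.mk.injEq, funext_iff, eq_iff_iff]

theorem atomicType_comp_embedding (g : M ↪[L₁] N) (u : ι → M) :
    atomicType (g ∘ u) = atomicType u := by
  simp only [atomicType_eq_iff, Function.comp_apply, F_map_embedding, E_map_embedding,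
    eval_map_embedding, g.injective.eq_iff, implies_true, and_self]

end AtomicType

namespace Pt

variable {r : ℕ → ℕ → ℕ}

@[simp] theorem eval_self (x : Pt r) : eval x x = x := by
  cases x <;> simp

theorem F_eval (x y : Pt r) : F (eval x y) ↔ F x ∧ F y := by
  cases x <;> cases y <;> simp

theorem E_eval_left (x y z : Pt r) : E (eval x y) z ↔ E x z ∨ F x ∧ E y z := by
  cases x <;> cases y <;> cases z <;> simp

theorem E_eval_right (x y z : Pt r) : E z (eval x y) ↔ E z x ∨ F x ∧ E z y := by
  cases x <;> cases y <;> cases z <;> simp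

/-- The set of indices of the functions in a set of points. -/
def fns (X : Set (Pt r)) : Set ℕ := {f | fn f ∈ X}

/-- The set of indices of the classes that meet a set of points. -/
def classes (X : Set (Pt r)) : Set ℕ := {κ | ∃ n, obj κ n ∈ X}

@[simp] theorem mem_fns {X : Set (Pt r)} {f : ℕ} : f ∈ fns X ↔ fn f ∈ X := Iff.rfl

theorem mem_classes {X : Set (Pt r)} {κ n : ℕ} (h : obj κ n ∈ X) : κ ∈ classes X := ⟨n, h⟩

theorem finite_fns {X : Set (Pt r)} (hX : X.Finite) : (fns X).Finite :=
  hX.preimage fun _ _ _ _ h => by injection h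

/-- The index of the class of an object; the value on functions is irrelevant. -/
def classOf : Pt r → ℕ
  | obj κ _ => κ
  | fn _ => 0

theorem finite_classes {X : Set (Pt r)} (hX : X.Finite) : (classes X).Finite :=
  (hX.image classOf).subset fun _ ⟨_, h⟩ => ⟨_, h, rfl⟩

end Pt

theorem exists_perm_of_finite {R : Set (ℕ × ℕ)} (hR : R.Finite)
    (h : ∀ p ∈ R, ∀ q ∈ R, p.1 = q.1 ↔ p.2 = q.2) : ∃ g : Perm ℕ, ∀ p ∈ R, g p.1 = p.2 := by
  have := hR.to_subtype
  obtain ⟨g, hg⟩ := Perm.exists_extending_pair (fun p : R => p.1.1) (fun p : R => p.1.2)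
    (fun p q hpq => Subtype.ext (Prod.ext hpq ((h p p.2 q q.2).1 hpq)))
    (fun p q hpq => Subtype.ext (Prod.ext ((h p p.2 q q.2).2 hpq) hpq))
  exact ⟨g, fun p hp => hg ⟨p, hp⟩⟩

open Pt

variable {r r' : ℕ → ℕ → ℕ} {ι : Type*} [Finite ι]

theorem exists_reductIso {w : ι → Pt r} {w' : ι → Pt r'} (hF : ∀ i, F (w i) ↔ F (w' i))
    (hE : ∀ i j, E (w i) (w j) ↔ E (w' i) (w' j)) (heq : ∀ i j, w i = w j ↔ w' i = w' j) :
    ∃ A : ReductIso, ∀ i, A.toEquiv (w i) = w' i := by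
  have hfin : (Set.range fun i => (w i, w' i)).Finite := Set.finite_range _
  obtain ⟨σ, hσ⟩ := exists_perm_of_finite (R := {p | ∃ i, w i = fn p.1 ∧ w' i = fn p.2})
    ((hfin.preimage (f := fun p => (fn p.1, fn p.2)) fun _ _ _ _ h => by
        simpa [Prod.ext_iff] using h).subset fun p ⟨i, hi, hi'⟩ => ⟨i, by simp only [hi, hi']⟩)
    (by rintro ⟨f, f'⟩ ⟨i, hi, hi'⟩ ⟨g, g'⟩ ⟨j, hj, hj'⟩; simpa [hi, hi', hj, hj'] using heq i j)
  obtain ⟨τ, hτ⟩ := exists_perm_of_finite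
    (R := {p | ∃ i n n', w i = obj p.1 n ∧ w' i = obj p.2 n'})
    ((hfin.image (Prod.map classOf classOf)).subset
      fun p ⟨i, n, n', hi, hi'⟩ => ⟨_, ⟨i, rfl⟩, by simp [hi, hi', classOf]⟩)
    (by
      rintro ⟨κ, κ'⟩ ⟨i, n, n', hi, hi'⟩ ⟨l, l'⟩ ⟨j, m, m', hj, hj'⟩
      simpa [hi, hi', hj, hj'] using hE i j)
  have hh (κ : ℕ) : ∃ g : Perm ℕ, ∀ p ∈ {p : ℕ × ℕ | ∃ i, w i = obj κ p.1 ∧ w' i = obj (τ κ) p.2},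
      g p.1 = p.2 := exists_perm_of_finite
    ((hfin.preimage (f := fun p => (obj κ p.1, obj (τ κ) p.2)) fun _ _ _ _ h => by
        simpa [Prod.ext_iff] using h).subset fun p ⟨i, hi, hi'⟩ => ⟨i, by simp only [hi, hi']⟩)
    (by rintro ⟨n, n'⟩ ⟨i, hi, hi'⟩ ⟨m, m'⟩ ⟨j, hj, hj'⟩; simpa [hi, hi', hj, hj'] using heq i j)
  choose h hh using hh
  refine ⟨⟨σ, τ, h⟩, fun i => ?_⟩
  rcases hi : w i with ⟨κ, n⟩ | f <;> rcases hi' : w' i with ⟨κ', n'⟩ | f'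
  · have hκ : τ κ = κ' := hτ (κ, κ') ⟨i, n, n', hi, hi'⟩
    have hn : h κ n = n' := hh κ (n, n') ⟨i, hi, by rw [hi', hκ]⟩
    simp [hκ, hn]
  · simpa [hi, hi'] using hF i
  · simpa [hi, hi'] using hF i
  · simpa using hσ (f, f') ⟨i, hi, hi'⟩

theorem exists_partialIso {u : ι → Pt r} {u' : ι → Pt r'} (h : atomicType u = atomicType u') :
    ∃ A : PartialIso r r', A.fns = fns (Set.range u) ∧ A.classes = classes (Set.range u) ∧
      A.Maps u u' := by
  obtain ⟨hF, hE, heval⟩ := atomicType_eq_iff.1 h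
  obtain ⟨A, hA⟩ := exists_reductIso
    (w := fun p : ι × ι => eval (u p.1) (u p.2)) (w' := fun p => eval (u' p.1) (u' p.2))
    (fun p => by simp only [F_eval, hF])
    (fun p q => by simp only [E_eval_left, E_eval_right, hF, hE])
    fun p q => heval p.1 p.2 q.1 q.2
  have hAu (i) : A.toEquiv (u i) = u' i := by simpa using hA (i, i)
  refine ⟨⟨A, fns (Set.range u), classes (Set.range u), finite_fns (Set.finite_range u),
    finite_classes (Set.finite_range u), ?_⟩, rfl, rfl, fun i => ⟨?_, hAu i⟩⟩
  · rintro f ⟨i, hi⟩ κ ⟨n, j, hj⟩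
    have hij := hA (i, j)
    simp only [← hAu, hi, hj, eval_fn_obj, ReductIso.toEquiv_obj, ReductIso.toEquiv_fn,
      obj.injEq, true_and] at hij
    exact hij.symm
  · rcases hi : u i with ⟨κ, n⟩ | f
    exacts [⟨n, i, hi⟩, ⟨i, hi⟩]

end AtomicTypes

/-! ### Rich structures -/

section Richness

variable {L : FirstOrder.Language.{0, 0}} {M N : Type} [L.Structure M] [L.Structure N]

theorem realize_of_completeTheory [N ⊨ L.completeTheory M] {α : Type} [Finite α]
    (θ : L.Formula α) (h : ∀ v : α → M, θ.Realize v) (v : α → N) : θ.Realize v := by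
  have key {P : Type} [L.Structure P] :
      P ⊨ ((θ.relabel Sum.inr : L.Formula (Empty ⊕ α)).iAlls α : L.Sentence) ↔
        ∀ v : α → P, θ.Realize v := by
    rw [Sentence.Realize, Formula.realize_iAlls]
    simp only [Formula.realize_relabel]
    rfl
  exact key.1 ((realize_iff_of_model_completeTheory M N _).2 (key.2 h)) v

/-- The age-theoretic property that characterizes the Fraïssé limit of the class of finite models
of `T` among structures with finite finitely generated substructures: embeddings of substructures
of finite models of `T` extend to these models. -/
def IsRich (T : L.Theory) (M : Type) [L.Structure M] : Prop :=
  ∀ (K : Type) [L.Structure K] [Finite K], K ⊨ T → ∀ (S : L.Substructure K) (f : S ↪[L] M),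
    ∃ g : K ↪[L] M, g.comp S.subtype = f

theorem IsRich.isExtensionPair {T : L.Theory} (hM : IsRich T M)
    (hN : ∀ S : L.Substructure N, S.FG → Finite S ∧ S ⊨ T) : L.IsExtensionPair N M := by
  rw [isExtensionPair_iff_exists_embedding_closure_singleton_sup]
  intro S hS f m
  obtain ⟨hfin, hT⟩ := hN (Substructure.closure L {m} ⊔ S)
    ((Substructure.fg_closure_singleton m).sup hS)
  let i : S ↪[L] (Substructure.closure L {m} ⊔ S : L.Substructure N) :=
    Substructure.inclusion le_sup_right
  obtain ⟨g, hg⟩ := hM _ hT i.toHom.range (f.comp i.equivRange.symm.toEmbedding)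
  refine ⟨g, Embedding.ext fun x => ?_⟩
  calc f x = f (i.equivRange.symm (i.equivRange x)) := by rw [i.equivRange.symm_apply_apply]
    _ = g (i.equivRange x) := (DFunLike.congr_fun hg (i.equivRange x)).symm

variable [Finite (Σ n, L.Functions n)] [Finite (Σ n, L.Relations n)]

/-- The conjunction of the atomic and negated atomic formulas that hold in the finite
structure `K`, in variables indexed by `K`. -/
noncomputable def diagram (K : Type) [Finite K] [L.Structure K] : L.Formula K :=
  (Formula.iInf fun p : {p : K × K // p.1 ≠ p.2} =>
    ∼((Term.var p.1.1).equal (Term.var p.1.2))) ⊓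
  (Formula.iInf fun p : Σ f : (Σ n, L.Functions n), Fin f.1 → K =>
    (Term.func p.1.2 (Term.var ∘ p.2)).equal (Term.var (Structure.funMap p.1.2 p.2))) ⊓
  (Formula.iInf fun p : {p : Σ R : (Σ n, L.Relations n), Fin R.1 → K //
      Structure.RelMap p.1.2 p.2} => p.1.1.2.formula (Term.var ∘ p.1.2)) ⊓
  (Formula.iInf fun p : {p : Σ R : (Σ n, L.Relations n), Fin R.1 → K //
      ¬ Structure.RelMap p.1.2 p.2} => ∼(p.1.1.2.formula (Term.var ∘ p.1.2)))

theorem realize_diagram {K : Type} [Finite K] [L.Structure K] {v : K → M} :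
    (diagram K : L.Formula K).Realize v ↔ ∃ g : K ↪[L] M, ⇑g = v := by
  have hrel {n : ℕ} (R : L.Relations n) (a : Fin n → K) :
      (R.formula (Term.var ∘ a)).Realize v ↔ Structure.RelMap R (v ∘ a) := by
    rw [Formula.realize_rel]
    rfl
  simp only [diagram, Formula.realize_inf, Formula.realize_iInf, Formula.realize_not,
    Formula.realize_equal, Term.realize_var, Term.realize_func, Function.comp_apply, hrel,
    Subtype.forall, Sigma.forall, Prod.forall]
  constructor
  · rintro ⟨⟨⟨hne, hfun⟩, hpos⟩, hneg⟩
    refine ⟨⟨⟨v, fun x y => not_imp_not.1 (hne x y)⟩, fun f a => (hfun _ f a).symm,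
      fun R a => ⟨not_imp_not.1 (hneg _ R a), hpos _ R a⟩⟩, rfl⟩
  · rintro ⟨g, rfl⟩
    exact ⟨⟨⟨fun x y => g.injective.ne, fun n f a => (g.map_fun f a).symm⟩,
      fun n R a => (g.map_rel R a).2⟩, fun n R a => mt (g.map_rel R a).1⟩

/-- Richness is expressed by sentences: every tuple with the diagram of `S` extends to one with
the diagram of `K`. -/
theorem IsRich.of_completeTheory {T : L.Theory} (hM : IsRich T M) (N : Type) [L.Structure N]
    [N ⊨ L.completeTheory M] : IsRich T N := by
  intro K _ _ hK S f
  let θ : L.Formula S := (diagram S).imp (Formula.iExs K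
    ((diagram K : L.Formula K).relabel Sum.inr ⊓
      Formula.iInf fun s : S => (Term.var (Sum.inr s.1)).equal (Term.var (Sum.inl s))))
  have hθ {P : Type} [L.Structure P] (u : S → P) : θ.Realize u ↔
      ((∃ f : S ↪[L] P, ⇑f = u) → ∃ y, (∃ g : K ↪[L] P, ⇑g = y) ∧ ∀ s : S, y s = u s) := by
    simp only [θ, Formula.realize_imp, realize_diagram, Formula.realize_iExs, Formula.realize_inf,
      Formula.realize_relabel, Formula.realize_iInf, Formula.realize_equal, Term.realize_var,
      Sum.elim_inl, Sum.elim_inr, Sum.elim_comp_inr]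
  have hθM (u : S → M) : θ.Realize u := by
    rw [hθ]
    rintro ⟨f, rfl⟩
    obtain ⟨g, hg⟩ := hM K hK S f
    exact ⟨g, ⟨g, rfl⟩, DFunLike.congr_fun hg⟩
  obtain ⟨_, ⟨g, rfl⟩, hg⟩ := (hθ f).1 (realize_of_completeTheory θ hθM f) ⟨f, rfl⟩
  exact ⟨g, Embedding.ext hg⟩

end Richness

/-! ### The Fraïssé limit -/

section Limit

open Equiv Pt

instance : Finite (Σ n, L₁.Functions n) :=
  Finite.of_injective (β := Unit) (fun _ => ()) (by rintro ⟨_, ⟨⟩⟩ ⟨_, ⟨⟩⟩ _; rfl)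

instance : Finite (Σ n, L₁.Relations n) :=
  Finite.of_surjective (α := Fin 3) ![⟨1, Rel.O⟩, ⟨1, Rel.F⟩, ⟨2, Rel.E⟩]
    (by rintro ⟨_, ⟨⟩⟩; exacts [⟨0, rfl⟩, ⟨1, rfl⟩, ⟨2, rfl⟩])

instance : IsEmpty L₁.Constants := ⟨nofun⟩

instance : IsEmpty (L₁.Relations 0) := ⟨nofun⟩

section Eval

variable {M : Type*} [L₁.Structure M]

theorem eval_self (h : M ⊨ T₁) (x : M) : eval x x = x := by
  obtain ⟨hOF, -, -, -, -, -, -, hjunk⟩ := (model_T₁_iff M).1 h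
  exact hjunk x x fun hx => (hOF x).1 hx.2 hx.1

theorem image2_eval_subset (h : M ⊨ T₁) (X : Set M) :
    Set.image2 eval (Set.image2 eval X X) (Set.image2 eval X X) ⊆ Set.image2 eval X X := by
  obtain ⟨hOF, hEO, -, -, -, hE, hcongr, hjunk⟩ := (model_T₁_iff M).1 h
  have eval_eval_left (a b y : M) :
      eval (eval a b) y = eval a b ∨ eval (eval a b) y = eval a y := by
    by_cases hab : F a ∧ O b
    · exact .inl (hjunk _ _ fun hy => (hOF _).1 (hEO _ _ (hE a b hab.1 hab.2)).1 hy.1)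
    · rw [hjunk a b hab]
      exact .inr rfl
  have eval_eval_right (a b c : M) :
      eval a (eval b c) = eval a b ∨ eval a (eval b c) = eval a c := by
    by_cases hbc : F b ∧ O c
    · by_cases ha : F a
      · exact .inr (hcongr a _ _ ha (hE b c hbc.1 hbc.2))
      · exact .inr ((hjunk _ _ fun h => ha h.1).trans (hjunk _ _ fun h => ha h.1).symm)
    · rw [hjunk b c hbc]
      exact .inl rfl
  rintro _ ⟨_, ⟨a, ha, b, hb, rfl⟩, _, ⟨c, hc, d, hd, rfl⟩, rfl⟩
  rcases eval_eval_left a b (eval c d) with h | h <;> rw [h]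
  · exact ⟨a, ha, b, hb, rfl⟩
  · rcases eval_eval_right a c d with h | h <;> rw [h]
    exacts [⟨a, ha, c, hc, rfl⟩, ⟨a, ha, d, hd, rfl⟩]

theorem finite_of_fg (h : M ⊨ T₁) {S : L₁.Substructure M} (hS : S.FG) : Finite S := by
  obtain ⟨X, rfl⟩ := hS
  let S : L₁.Substructure M :=
    { carrier := Set.image2 eval X X
      fun_mem := by
        rintro n ⟨⟩ v hv
        rw [← Function.id_comp v, comp_eq_vec₂]
        exact image2_eval_subset h X ⟨_, hv 0, _, hv 1, rfl⟩ }
  have hX : Substructure.closure L₁ (X : Set M) ≤ S :=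
    Substructure.closure_le.2 fun x hx => ⟨x, hx, x, hx, eval_self h x⟩
  exact ((X.finite_toSet.image2 eval X.finite_toSet).subset hX).to_subtype

end Eval

theorem exists_rep {M : Type*} [L₁.Structure M] (h : M ⊨ T₁) :
    ∃ rep : M → M, ∀ x, O x → E (rep x) x ∧ ∀ y, O y → (rep x = rep y ↔ E x y) := by
  obtain ⟨-, -, hrefl, hsymm, htrans, -, -, -⟩ := (model_T₁_iff M).1 h
  have hE (x y : M) (hy : O y) : E x = E y ↔ E x y :=
    ⟨fun h => h ▸ hrefl y hy, fun h => funext fun z => propext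
      ⟨htrans y x z (hsymm x y h), htrans x y z h⟩⟩
  let rep (x : M) : M := (Quotient.mk (Setoid.ker E) x).out
  have hrep (x : M) : E (rep x) = E x := Quotient.mk_out (s := Setoid.ker E) x
  refine ⟨rep, fun x hx => ⟨?_, fun y hy => ?_⟩⟩
  · rw [hrep]
    exact hrefl x hx
  · rw [← hE x y hy]
    exact Quotient.out_inj.trans Quotient.eq

theorem exists_embedding_of_countable {M : Type*} [L₁.Structure M] [Countable M] (h : M ⊨ T₁) :
    ∃ r, Nonempty (M ↪[L₁] Pt r) := by
  classical
  obtain ⟨rep, hrep⟩ := exists_rep h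
  obtain ⟨hOF, hEO, -, -, -, hE, hcongr, hjunk⟩ := (model_T₁_iff M).1 h
  obtain ⟨ν, hν⟩ := exists_injective_nat M
  obtain ⟨v, hv⟩ := exists_factor (p := fun i : M × M => Nat.pair (ν i.1) (ν (rep i.2)))
    (q := fun i => ν (eval i.1 (rep i.2))) (fun i j hij => by
      simp only [Nat.pair_eq_pair, hν.eq_iff] at hij ⊢
      rw [hij.1, hij.2])
  let g (x : M) : Pt fun f κ => v (Nat.pair f κ) :=
    if O x then obj (ν (rep x)) (ν x) else fn (ν x)
  have gO {x : M} (hx : O x) : g x = obj (ν (rep x)) (ν x) := if_pos hx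
  have gF {x : M} (hx : ¬ O x) : g x = fn (ν x) := if_neg hx
  refine ⟨_, ⟨mkEmbedding g ?_ ?_ ?_ ?_ ?_⟩⟩
  · intro x y hxy
    by_cases hx : O x <;> by_cases hy : O y <;> simp_all [hν.eq_iff]
  · intro x
    by_cases hx : O x <;> simp [hx, gO, gF]
  · intro x
    rw [← not_iff_not, ← hOF]
    by_cases hx : O x <;> simp [hx, gO, gF]
  · intro x y
    by_cases hx : O x <;> by_cases hy : O y
    · simp [gO hx, gO hy, hν.eq_iff, (hrep x hx).2 y hy]
    all_goals
      have hxy : ¬ E x y := fun h => by have := hEO x y h; tauto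
      simp [gO, gF, hx, hy, hxy]
  · intro x y
    by_cases hx : O x <;> by_cases hy : O y
    · simp [hjunk x y fun h => (hOF x).1 hx h.1, gO hx]
    · simp [hjunk x y fun h => (hOF x).1 hx h.1, gO hx]
    · have hFx : F x := by_contra fun h => hx ((hOF x).2 h)
      have hxy := hE x y hFx hy
      rw [gO (hEO _ _ hxy).1, gF hx, gO hy, eval_fn_obj, hv (x, y),
        hcongr x _ _ hFx (hrep y hy).1, ((hrep _ (hEO _ _ hxy).1).2 y hy).2 hxy]
    · simp [hjunk x y fun h => hy h.2, gF hx, gF hy]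

variable {r r' : ℕ → ℕ → ℕ}

/-- The composite of an embedding into the domain of a partial isomorphism with that partial
isomorphism. -/
def PartialIso.compEmbedding {M : Type*} [L₁.Structure M] (A : PartialIso r r') (g : M ↪[L₁] Pt r)
    (hg : Set.range g ⊆ A.dom) : M ↪[L₁] Pt r' :=
  mkEmbedding (A ∘ g) (A.toEquiv.injective.comp g.injective)
    (fun x => (A.O_toEquiv _).trans (O_map_embedding g x))
    (fun x => (A.F_toEquiv _).trans (F_map_embedding g x))
    (fun x y => (A.E_toEquiv _ _).trans (E_map_embedding g x y))
    (fun x y => by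
      rw [Function.comp_apply, ← eval_map_embedding g]
      exact A.map_eval (hg ⟨x, rfl⟩) (hg ⟨y, rfl⟩))

namespace Generic

theorem isRich (hr : Generic r) : IsRich T₁ (Pt r) := by
  intro K _ _ hK S f
  obtain ⟨q, ⟨i⟩⟩ := exists_embedding_of_countable hK
  obtain ⟨A, -, -, hA⟩ := exists_partialIso
    ((atomicType_comp_embedding (i.comp S.subtype) id).trans (atomicType_comp_embedding f id).symm)
  obtain ⟨B, hAB, hB⟩ := A.exists_extend_finite hr (Set.finite_range i)
  exact ⟨B.compEmbedding i hB, Embedding.ext fun s => (hA.mono hAB s).2⟩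

theorem isFraisseLimit (hr : Generic r) : IsFraisseLimit K₁ (Pt r) where
  ultrahomogeneous := (isUltrahomogeneous_iff_IsExtensionPair Structure.cg_of_countable).2 <|
    hr.isRich.isExtensionPair fun S hS =>
      ⟨finite_of_fg (model_T₁ r) hS, model_T₁_of_embedding S.subtype (model_T₁ r)⟩
  age := by
    ext K
    constructor
    · rintro ⟨hK, ⟨g⟩⟩
      have := finite_of_fg (model_T₁ r) (hK.range g.toHom)
      exact ⟨Finite.of_injective _ g.equivRange.injective, model_T₁_of_embedding g (model_T₁ r)⟩
    · rintro ⟨hfin, hK⟩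
      obtain ⟨g, -⟩ := hr.isRich K hK _ (default : L₁.FGEquiv K (Pt r)).1.toEmbedding
      exact ⟨Structure.FG.of_finite, ⟨g⟩⟩

theorem nonempty_equiv (hr : Generic r) (N : Type) [L₁.Structure N] [Countable N]
    [N ⊨ L₁.completeTheory (Pt r)] : Nonempty (Pt r ≃[L₁] N) := by
  have hN : N ⊨ T₁ := Theory.Model.mono (T' := L₁.completeTheory (Pt r)) inferInstance
    (Theory.model_iff_subset_completeTheory.1 (model_T₁ r))
  obtain ⟨e, -⟩ := equiv_between_cg (M := Pt r) (N := N) Structure.cg_of_countable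
    Structure.cg_of_countable default
    ((hr.isRich.of_completeTheory N).isExtensionPair fun S hS =>
      ⟨finite_of_fg (model_T₁ r) hS, model_T₁_of_embedding S.subtype (model_T₁ r)⟩)
    (hr.isRich.isExtensionPair fun S hS =>
      ⟨finite_of_fg hN hS, model_T₁_of_embedding S.subtype hN⟩)
  exact ⟨e⟩

theorem exists_elementaryEmbedding (hr : Generic r) {N : Type} [L₁.Structure N]
    [N ⊨ L₁.completeTheory (Pt r)] {ι : Type} [Countable ι] (w : ι → N) :
    ∃ (g : Pt r ↪ₑ[L₁] N) (w' : ι → Pt r), g ∘ w' = w := by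
  have hcard : L₁.card ≤ Cardinal.aleph0 :=
    Cardinal.mk_le_aleph0_iff.2 (inferInstanceAs (Countable (_ ⊕ _)))
  have hN : L₁.ElementarilyEquivalent (Pt r) N :=
    elementarilyEquivalent_iff.2 fun φ => (realize_iff_of_model_completeTheory (Pt r) N φ).symm
  have : Infinite N := hN.infinite
  obtain ⟨S, hS, hSN⟩ := exists_elementarySubstructure_card_eq L₁ (Set.range w) Cardinal.aleph0
    le_rfl (Cardinal.lift_le.2 (Cardinal.mk_le_aleph0_iff.2 (Set.countable_range w).to_subtype))
    (by simpa using hcard) (by simp)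
  have : Countable S := Cardinal.mk_le_aleph0_iff.1 (by simpa using hSN.le)
  obtain ⟨e⟩ := hr.nonempty_equiv S
  refine ⟨S.subtype.comp e.toElementaryEmbedding, fun a => e.symm ⟨w a, hS ⟨a, rfl⟩⟩, ?_⟩
  ext a
  simp

end Generic

/-- The `k`-th finitely supported function. -/
def decodeFun (k i : ℕ) : ℕ := (Denumerable.ofNat (List ℕ) k).getD i 0

/-- An explicit generic function: of `f` and `κ`, the larger one encodes the values at all smaller
arguments. -/
def explicitValue (f κ : ℕ) : ℕ :=
  if f < κ then decodeFun κ.unpair.2 f else decodeFun f.unpair.2 κ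

theorem exists_decodeFun {X : Set ℕ} (hX : X.Finite) (v : ℕ → ℕ) :
    ∃ c, ∀ i ∈ X, i < c ∧ decodeFun c.unpair.2 i = v i := by
  obtain ⟨b, hb⟩ := hX.bddAbove
  refine ⟨Nat.pair (b + 1) (Encodable.encode ((List.range (b + 1)).map v)), fun i hi => ?_⟩
  have hib : i < b + 1 := Nat.lt_succ_of_le (hb hi)
  exact ⟨hib.trans_le (Nat.left_le_pair _ _), by simp [decodeFun, hib]⟩

theorem generic_explicitValue : Generic explicitValue where
  exists_fn {Φ K} hΦ hK v := by
    obtain ⟨f, hf⟩ := exists_decodeFun (hΦ.union hK) v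
    refine ⟨f, fun h => (hf f (.inl h)).1.false, fun κ hκ => ?_⟩
    rw [explicitValue, if_neg (hf κ (.inr hκ)).1.not_gt, (hf κ (.inr hκ)).2]
  exists_class {Φ K} hΦ hK v := by
    obtain ⟨κ, hκ⟩ := exists_decodeFun (hΦ.union hK) v
    refine ⟨κ, fun h => (hκ κ (.inr h)).1.false, 1, fun f hf => ?_⟩
    rw [explicitValue, if_pos (hκ f (.inl hf)).1, (hκ f (.inl hf)).2, Perm.one_apply]

end Limit

/-! ### Simplicity of the type of an object -/

section Simplicity

open Equiv Pt

theorem exists_delta_system {M ι : Type*} [Finite ι] (x : ℕ → ι → M) :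
    ∃ (D : Set M) (f : ℕ → ℕ), D.Finite ∧ Function.Injective f ∧
      ∀ i j, i ≠ j → ∀ l l', x (f i) l = x (f j) l' → x (f i) l ∈ D := by
  let U : Ultrafilter ℕ := Filter.hyperfilter ℕ
  let D : Set M := {d | ∃ l, ∀ᶠ s in U, x s l = d}
  have hD : D.Finite := by
    refine (Set.finite_iUnion (f := fun l => {d | ∀ᶠ s in U, x s l = d}) fun l =>
      Set.Subsingleton.finite fun d hd d' hd' => ?_).subset fun d hd => Set.mem_iUnion.2 hd
    obtain ⟨s, hs, hs'⟩ := (Filter.Eventually.and hd hd').exists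
    exact hs.symm.trans hs'
  let Disj (q s : ℕ) : Prop := q ≠ s ∧ ∀ l l', x q l = x s l' → x q l ∈ D
  have : Std.Symm Disj := ⟨fun q s h => ⟨h.1.symm, fun l l' he => he ▸ h.2 l' l he.symm⟩⟩
  have hDisj (q : ℕ) : ∀ᶠ s in U, Disj q s := by
    refine Filter.Eventually.and ?_ (Filter.eventually_all.2 fun l =>
      Filter.eventually_all.2 fun l' => ?_)
    · filter_upwards [Filter.compl_mem_hyperfilter_of_finite (Set.finite_singleton q)] with s hs
      exact Ne.symm hs
    · by_cases hl : ∀ᶠ s in U, x s l' = x q l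
      · exact .of_forall fun s _ => ⟨l', hl⟩
      · filter_upwards [Ultrafilter.eventually_not.2 hl] with s hs he
        exact absurd he.symm hs
  obtain ⟨f, -, hf⟩ := exists_seq_of_forall_finset_exists' (fun _ => True) Disj fun T _ =>
    ((Filter.eventually_all_finset T).2 fun q _ => hDisj q).exists.imp fun _ h => ⟨trivial, h⟩
  exact ⟨D, f, hD, Function.injective_iff_pairwise_ne.2 fun i j hij => (hf hij).1,
    fun i j hij => (hf hij).2⟩

theorem exists_homogeneous_delta_system {M ι : Type*} [L₁.Structure M] [Finite ι] {C : Set M}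
    (hC : C.Finite) (x : ℕ → ι → M) :
    ∃ (D : Set M) (f : ℕ → ℕ), C ⊆ D ∧ D.Finite ∧ Function.Injective f ∧
      (∀ i j, atomicType (Sum.elim ((↑) : D → M) (x (f i))) =
        atomicType (Sum.elim ((↑) : D → M) (x (f j)))) ∧
      ∀ i j, i ≠ j → ∀ l l', x (f i) l = x (f j) l' → x (f i) l ∈ D := by
  obtain ⟨D, f, hD, hf, hdisj⟩ := exists_delta_system x
  have : Finite ↑(C ∪ D) := hC.union hD
  obtain ⟨t, ht⟩ := Finite.exists_infinite_fiber
    fun s => atomicType (Sum.elim ((↑) : ↑(C ∪ D) → M) (x (f s)))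
  let g := Set.Infinite.natEmbedding _ (Set.infinite_coe_iff.1 ht)
  refine ⟨C ∪ D, fun i => f (g i), Set.subset_union_left, this,
    hf.comp (Subtype.val_injective.comp g.injective), fun i j => (g i).2.trans (g j).2.symm,
    fun i j hij l l' he => .inr (hdisj _ _ ?_ l l' he)⟩
  exact (Subtype.val_injective.comp g.injective).ne hij

variable {r r' : ℕ → ℕ → ℕ}

namespace PartialIso

/-- The partial isomorphism with another choice `h` of the bijections between the classes, which
agrees with the old one on the values of the functions. -/
def replaceMaps (A : PartialIso r r') (h : ℕ → Perm ℕ)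
    (hh : ∀ f ∈ A.fns, ∀ κ ∈ A.classes, h κ (r f κ) = A.h κ (r f κ)) : PartialIso r r' :=
  { A with
    h := h
    map_value := fun f hf κ hκ => (A.map_value f hf κ hκ).trans (hh f hf κ hκ).symm }

variable {S β : Type*} [Finite S] {A : S → PartialIso r r'} {v : β → Pt r} {w : S → β → Pt r'}
  {κ : ℕ}

theorem exists_common_image_of_mem_classes [Finite β] (hA : ∀ s, (A s).Maps v (w s))
    (hκ : ∀ s, κ ∈ (A s).classes) {κ' : ℕ} (hτ : ∀ s, (A s).τ κ = κ') {m : ℕ}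
    (hv : ∀ b, v b ≠ obj κ m) (hm : ∀ s, ∀ f ∈ (A s).fns, r f κ ≠ m) :
    ∃ b : Fin 1 → Pt r', ∀ s, ∃ B : PartialIso r r',
      B.Maps (Sum.elim (fun _ => obj κ m) v) (Sum.elim b (w s)) := by
  have hfin : (⋃ s, (fun f => r' ((A s).σ f) κ') '' (A s).fns ∪
      {n | obj κ' n ∈ Set.range (w s)}).Finite :=
    Set.finite_iUnion fun s => ((A s).finite_fns.image _).union
      ((Set.finite_range (w s)).preimage fun _ _ _ _ h => by injection h)
  obtain ⟨n, hn⟩ := hfin.exists_notMem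
  simp only [Set.mem_iUnion, not_exists, Set.mem_union, not_or] at hn
  let g (s : S) : Perm ℕ := ((A s).h κ).trans (swap ((A s).h κ m) n)
  refine ⟨fun _ => obj κ' n, fun s => ⟨(A s).replaceMaps (Function.update (A s).h κ (g s)) ?_,
    Maps.elim (fun _ => ⟨hκ s, ?_⟩) fun b => ⟨(hA s b).1, ?_⟩⟩⟩
  · intro f hf i hi
    rcases eq_or_ne i κ with rfl | hne
    · rw [Function.update_self, trans_apply, swap_apply_of_ne_of_ne]
      · exact (Equiv.injective _).ne (hm s f hf)
      · rw [← (A s).map_value f hf i hi, hτ]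
        exact fun h => (hn s).1 ⟨f, hf, h⟩
    · rw [Function.update_of_ne hne]
  · simp [replaceMaps, g, hτ]
  · rw [← (hA s b).2]
    rcases hb : v b with ⟨i, j⟩ | f
    · rcases eq_or_ne i κ with rfl | hne
      · have hj : j ≠ m := fun h => hv b (h ▸ hb)
        have hn' : (A s).h i j ≠ n := fun h =>
          (hn s).2 ⟨b, by rw [← (hA s b).2, hb, ReductIso.toEquiv_obj, hτ s, h]⟩
        simp [replaceMaps, g, swap_apply_of_ne_of_ne ((Equiv.injective _).ne hj) hn']
      · simp [replaceMaps, hne]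
    · rfl

theorem exists_common_image_of_notMem_classes (hr' : Generic r') (hA : ∀ s, (A s).Maps v (w s))
    (hκ : ∀ s, κ ∉ (A s).classes)
    (hσ : ∀ s, ∀ f ∈ (A s).fns, ∀ s', ∀ f' ∈ (A s').fns, (A s).σ f = (A s').σ f' → f = f')
    (m : ℕ) :
    ∃ b : Fin 1 → Pt r', ∀ s, ∃ B : PartialIso r r',
      B.Maps (Sum.elim (fun _ => obj κ m) v) (Sum.elim b (w s)) := by
  obtain ⟨κ', g, hg⟩ := hr'.exists_common_class A κ
    fun s f hf s' f' hf' h => by rw [hσ s f hf s' f' hf' h]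
  refine ⟨fun _ => obj κ' (g m), fun s => ⟨_, Maps.elim (fun _ => ⟨Set.mem_insert κ _, ?_⟩)
    ((hA s).mono (le_adjoinClass (hκ s) (hg s).1 (hg s).2))⟩⟩
  exact adjoinClass_apply_self _ _ _ m

end PartialIso

namespace Pt

/-- The underlying set of the substructure generated by a set of points. -/
def cl (X : Set (Pt r)) : Set (Pt r) := Set.image2 eval X X

variable {X : Set (Pt r)}

theorem subset_cl (X : Set (Pt r)) : X ⊆ cl X := fun x hx => ⟨x, hx, x, hx, eval_self x⟩

theorem finite_cl (hX : X.Finite) : (cl X).Finite := hX.image2 eval hX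

theorem value_mem_cl {f κ : ℕ} (hf : f ∈ fns X) (hκ : κ ∈ classes X) : obj κ (r f κ) ∈ cl X :=
  have ⟨n, hn⟩ := hκ
  ⟨fn f, hf, obj κ n, hn, eval_fn_obj f κ n⟩

theorem classes_mono {X Y : Set (Pt r)} (h : X ⊆ Y) : classes X ⊆ classes Y :=
  fun _ ⟨n, hn⟩ => ⟨n, h hn⟩

theorem classes_cl (X : Set (Pt r)) : classes (cl X) = classes X := by
  refine Set.Subset.antisymm ?_ (classes_mono (subset_cl X))
  rintro κ ⟨n, ⟨κ', m⟩ | g, hg, ⟨κ'', m'⟩ | _, hx, h⟩ <;>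
    simp only [eval_obj, eval_fn_obj, eval_fn_fn, obj.injEq, reduceCtorEq] at h
  exacts [⟨m, h.1 ▸ hg⟩, ⟨m, h.1 ▸ hg⟩, ⟨m', h.1 ▸ hx⟩]

end Pt

theorem eq_of_apply_eq {ι β : Type*} {A : ι → PartialIso r r'} {D : Set (Pt r)} {g : D → Pt r'}
    {v : β → Pt r} {w : ι → β → Pt r'} (hA : ∀ i, (A i).Maps (Sum.elim (↑) v) (Sum.elim g (w i)))
    (hdisj : ∀ i j, i ≠ j → ∀ l l', w i l = w j l' → w i l ∈ Set.range g) {i j : ι} {p q : Pt r}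
    (hp : p ∈ D ∪ Set.range v) (hq : q ∈ D ∪ Set.range v) (h : A i p = A j q) : p = q := by
  have hD (i : ι) (d : D) : A i d = g d := (hA i (.inl d)).2
  have hv (i : ι) (l : β) : A i (v l) = w i l := (hA i (.inr l)).2
  rcases hp with hp | ⟨l, rfl⟩
  · exact (A j).toEquiv.injective ((hD j ⟨p, hp⟩).trans ((hD i ⟨p, hp⟩).symm.trans h))
  rcases hq with hq | ⟨l', rfl⟩
  · exact (A i).toEquiv.injective (h.trans ((hD j ⟨q, hq⟩).trans (hD i ⟨q, hq⟩).symm))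
  rcases eq_or_ne i j with rfl | hij
  · exact (A i).toEquiv.injective h
  rw [hv, hv] at h
  obtain ⟨d, hd⟩ := hdisj i j hij l l' h
  exact ((A i).toEquiv.injective ((hv i l).trans (hd.symm.trans (hD i d).symm))).trans
    ((A j).toEquiv.injective ((hD j d).trans (hd.trans (h.trans (hv j l').symm))))

section TreeProperty

open TreeProperties

theorem not_forall_mem_of_kInconsistent {ι X : Type*} {k : ℕ} {D : ι → Set X}
    (hD : KInconsistent k D) {f : ℕ → ι} (hf : Function.Injective f) (b : X) :
    ¬ ∀ i : Fin k, b ∈ D (f i) := fun hb =>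
  hD ((Finset.range k).map ⟨f, hf⟩) (by simp) ⟨b, by simpa using fun i hi => hb ⟨i, hi⟩⟩

theorem exists_new_of_kInconsistent (hr : Generic r) {n k : ℕ} (φ : L₁.Formula (Fin 1 ⊕ Fin n))
    {C : Set (Pt r)} (hC : C.Finite) {x : ℕ → Fin n → Pt r}
    (hk : KInconsistent k fun i => solutions φ (x i)) :
    ∃ (s : ℕ) (C' : Set (Pt r)), C ⊆ C' ∧ C'.Finite ∧ ∀ κ m,
      (fun _ => obj κ m) ∈ solutions φ (x s) →
        κ ∈ classes C' \ classes C ∨ obj κ m ∈ C' \ C := by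
  obtain ⟨D, f, hCD, hD, hf, htype, hdisj⟩ := exists_homogeneous_delta_system hC x
  have : Finite D := hD
  choose A hfns hclasses hA using fun i => exists_partialIso (htype 0 i)
  have hfix (i : ℕ) (d : Pt r) (hd : d ∈ D) : A i d = d := (hA i (.inl ⟨d, hd⟩)).2
  have hmap (i : ℕ) : (A i).Maps (x (f 0)) (x (f i)) := fun l => hA i (.inr l)
  simp only [Set.Sum.elim_range, Subtype.range_coe_subtype, Set.ofPred_mem_eq] at hfns hclasses
  have hCC' : C ⊆ cl (D ∪ Set.range (x (f 0))) :=
    (hCD.trans Set.subset_union_left).trans (subset_cl _)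
  refine ⟨f 0, cl (D ∪ Set.range (x (f 0))), hCC', finite_cl (hD.union (Set.finite_range _)),
    fun κ m hφ => ?_⟩
  by_contra hnew
  simp only [Set.mem_sdiff, not_or, not_and_not_right, classes_cl] at hnew
  obtain ⟨hκ, hm⟩ := hnew
  suffices ∃ b : Fin 1 → Pt r, ∀ i : Fin k, ∃ B : PartialIso r r,
      B.Maps (Sum.elim (fun _ => obj κ m) (x (f 0))) (Sum.elim b (x (f i))) by
    obtain ⟨b, hb⟩ := this
    exact not_forall_mem_of_kInconsistent hk hf b fun i =>
      have ⟨B, hB⟩ := hb i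
      (hB.realize_iff hr hr φ).1 hφ
  by_cases hκX : κ ∈ classes (D ∪ Set.range (x (f 0)))
  · by_cases hmX : obj κ m ∈ cl (D ∪ Set.range (x (f 0)))
    · have hself (i : Fin k) : (A i).Maps (fun _ : Fin 1 => obj κ m) (fun _ => obj κ m) := fun _ =>
        ⟨PartialIso.obj_mem_dom.2 ((hclasses i).symm ▸ hκX), hfix i _ (hCD (hm hmX))⟩
      exact ⟨fun _ => obj κ m, fun i => ⟨A i, (hself i).elim (hmap i)⟩⟩
    · obtain ⟨m₀, hm₀⟩ := hκ hκX
      refine PartialIso.exists_common_image_of_mem_classes (A := fun i : Fin k => A i)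
        (κ' := κ) (fun i => hmap i) (fun i => (hclasses i).symm ▸ hκX) (fun i => ?_) ?_ ?_
      · exact congrArg classOf (hfix i _ (hCD hm₀))
      · exact fun b hb => hmX (subset_cl _ (.inr ⟨b, hb⟩))
      · rintro i f hf rfl
        exact hmX (value_mem_cl (hfns i ▸ hf) hκX)
  · refine PartialIso.exists_common_image_of_notMem_classes hr (A := fun i : Fin k => A i)
      (fun i => hmap i) (fun i => (hclasses i).symm ▸ hκX) (fun i f hf i' f' hf' he => ?_) m
    exact fn.inj (eq_of_apply_eq (g := Subtype.val) hA (by simpa using hdisj)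
      (i := i) (j := i') (mem_fns.1 (hfns i ▸ hf)) (mem_fns.1 (hfns i' ▸ hf')) (congrArg fn he))

theorem Generic.not_treeProperty (hr : Generic r) {n k : ℕ} (φ : L₁.Formula (Fin 1 ⊕ Fin n))
    (a : List ℕ → Fin n → Pt r)
    (hk : ∀ η : List ℕ, KInconsistent k fun i : ℕ => solutions φ (a (η ++ [i]))) :
    ∃ η : List ℕ, ∀ b : Fin 1 → Pt r, O (b 0) → ∃ μ, μ <+: η ∧ b ∉ solutions φ (a μ) := by
  obtain ⟨s₁, C₁, -, hC₁, H₁⟩ := exists_new_of_kInconsistent hr φ Set.finite_empty (hk [])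
  obtain ⟨s₂, C₂, -, hC₂, H₂⟩ := exists_new_of_kInconsistent hr φ hC₁ (hk [s₁])
  obtain ⟨s₃, C₃, -, -, H₃⟩ := exists_new_of_kInconsistent hr φ hC₂ (hk [s₁, s₂])
  refine ⟨[s₁, s₂, s₃], fun b hb => ?_⟩
  by_contra! hcon
  obtain ⟨κ, m, hb⟩ := exists_eq_obj hb
  obtain rfl : b = fun _ => obj κ m := funext fun i => (congrArg b (Subsingleton.elim i 0)).trans hb
  have hκ₁ : κ ∈ classes C₁ := (H₁ κ m (hcon _ (by simp))).elim And.left fun h => ⟨m, h.1⟩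
  have hm₂ : obj κ m ∈ C₂ := ((H₂ κ m (hcon _ (by simp))).resolve_left fun h => h.2 hκ₁).1
  exact (H₃ κ m (hcon _ (by simp))).elim (fun h => h.2 ⟨m, hm₂⟩) fun h => h.2 hm₂

end TreeProperty

end Simplicity

/-! ### Coherent families of partial isomorphisms -/

section Coherence

open Pt

namespace PartialIso

variable {r r' : ℕ → ℕ → ℕ} {S : Type*}

/-- A family of partial isomorphisms that can be extended simultaneously by a common image of a new
class, or of a new function from `Φ`: functions with a common image are equal, and values of
functions from `Φ` in classes with a common image have a common image. -/
structure Coherent (Φ : Set ℕ) (A : S → PartialIso r r') : Prop where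
  eq_of_fn : ∀ s, ∀ f ∈ (A s).fns, ∀ t, ∀ g ∈ (A t).fns, (A s).σ f = (A t).σ g → f = g
  eq_on_values : ∀ s, ∀ κ ∈ (A s).classes, ∀ t, ∀ l ∈ (A t).classes,
    (A s).τ κ = (A t).τ l → ∀ f ∈ Φ, (A s).h κ (r f κ) = (A t).h l (r f l)

/-- The point `x` lies in the domains of all members of the family `A`, with the same image, or in
none of these domains. -/
def AgreeAt (A : S → PartialIso r r') (x : Pt r) : Prop :=
  ∀ s, x ∈ (A s).dom → ∀ s', x ∈ (A s').dom ∧ A s' x = A s x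

variable {Φ : Set ℕ} {A B : S → PartialIso r r'}

theorem AgreeAt.mono {x : Pt r} (hx : AgreeAt A x) (hAB : ∀ s, A s ≤ B s)
    (hB : ∀ s, x ∈ (B s).dom → x ∈ (A s).dom) : AgreeAt B x := fun s hs s' => by
  obtain ⟨hs', h⟩ := hx s (hB s hs) s'
  exact ⟨(hAB s').1 hs', by rw [(hAB s').2 hs', (hAB s).2 (hB s hs), h]⟩

namespace Coherent

variable [Finite S]

theorem exists_extend_class (hr' : Generic r') (h : Coherent Φ A) {κ : ℕ}
    (hκ : ∀ s, κ ∉ (A s).classes) :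
    ∃ B : S → PartialIso r r', (∀ s, A s ≤ B s) ∧ Coherent Φ B ∧ (∀ s, κ ∈ (B s).classes) ∧
      ∀ y, AgreeAt A y → AgreeAt B y := by
  obtain ⟨κ', g, hg⟩ := hr'.exists_common_class A κ
    fun s f hf s' f' hf' he => by rw [h.eq_of_fn s f hf s' f' hf' he]
  let B (s : S) : PartialIso r r' := (A s).adjoinClass κ κ' g (hκ s) (hg s).1 (hg s).2
  have hAB (s : S) : A s ≤ B s := le_adjoinClass (hκ s) (hg s).1 (hg s).2
  have hB (s : S) (n : ℕ) : B s (obj κ n) = obj κ' (g n) :=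
    adjoinClass_apply_self (hκ s) (hg s).1 (hg s).2 n
  refine ⟨B, hAB, ⟨h.eq_of_fn, ?_⟩, fun s => Set.mem_insert κ _, ?_⟩
  · have hold (s : S) {i : ℕ} (hi : i ∈ (A s).classes) (n : ℕ) : B s (obj i n) = A s (obj i n) :=
      (hAB s).2 (obj_mem_dom.2 hi)
    have hτ (s : S) : (B s).τ κ = κ' := congrArg classOf (hB s 0)
    rintro s i (rfl | hi) s' i' (rfl | hi') he f hf
    · exact (obj.inj ((hB s _).trans (hB s' _).symm)).2
    · rw [hτ, (obj.inj (hold s' hi' 0)).1] at he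
      exact ((hg s').1 ⟨i', hi', he.symm⟩).elim
    · rw [hτ, (obj.inj (hold s hi 0)).1] at he
      exact ((hg s).1 ⟨i, hi, he⟩).elim
    · rw [(obj.inj (hold s hi _)).2, (obj.inj (hold s' hi' _)).2]
      rw [(obj.inj (hold s hi 0)).1, (obj.inj (hold s' hi' 0)).1] at he
      exact h.eq_on_values s i hi s' i' hi' he f hf
  · rintro (⟨i, n⟩ | f) hy
    · rcases eq_or_ne i κ with rfl | hne
      · exact fun s _ s' => ⟨Set.mem_insert i _, (hB s' n).trans (hB s n).symm⟩
      · exact hy.mono hAB fun s hs => hs.resolve_left hne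
    · exact hy.mono hAB fun s hs => hs

theorem exists_extend_fn (hr' : Generic r') (h : Coherent Φ A) {f : ℕ} (hfΦ : f ∈ Φ)
    (hf : ∀ s, f ∉ (A s).fns) :
    ∃ B : S → PartialIso r r', (∀ s, A s ≤ B s) ∧ Coherent Φ B ∧ (∀ s, f ∈ (B s).fns) ∧
      ∀ y, AgreeAt A y → AgreeAt B y := by
  obtain ⟨f', hf'⟩ := hr'.exists_common_fn A f
    fun s κ hκ s' κ' hκ' he => h.eq_on_values s κ hκ s' κ' hκ' he f hfΦ
  let B (s : S) : PartialIso r r' := (A s).adjoinFn f f' (hf s) (hf' s).1 (hf' s).2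
  have hAB (s : S) : A s ≤ B s := le_adjoinFn (hf s) (hf' s).1 (hf' s).2
  have hB (s : S) : B s (fn f) = fn f' := adjoinFn_apply_self (hf s) (hf' s).1 (hf' s).2
  refine ⟨B, hAB, ⟨?_, h.eq_on_values⟩, fun s => Set.mem_insert f _, ?_⟩
  · have hold (s : S) {i : ℕ} (hi : i ∈ (A s).fns) : (B s).σ i = (A s).σ i :=
      fn.inj ((hAB s).2 (fn_mem_dom.2 hi))
    have hσ (s : S) : (B s).σ f = f' := fn.inj (hB s)
    rintro s i (rfl | hi) s' i' (rfl | hi') he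
    · rfl
    · rw [hσ, hold s' hi'] at he
      exact ((hf' s').1 ⟨i', hi', he.symm⟩).elim
    · rw [hσ, hold s hi] at he
      exact ((hf' s).1 ⟨i, hi, he⟩).elim
    · rw [hold s hi, hold s' hi'] at he
      exact h.eq_of_fn s i hi s' i' hi' he
  · rintro (⟨κ, n⟩ | i) hy
    · exact hy.mono hAB fun s hs => hs
    · rcases eq_or_ne i f with rfl | hne
      · exact fun s _ s' => ⟨Set.mem_insert i _, (hB s').trans (hB s).symm⟩
      · exact hy.mono hAB fun s hs => hs.resolve_left hne

theorem exists_extend (hr' : Generic r') (h : Coherent Φ A) {x : Pt r} (hx : AgreeAt A x)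
    (hxΦ : ∀ f, x = fn f → f ∈ Φ) :
    ∃ B : S → PartialIso r r', (∀ s, A s ≤ B s) ∧ Coherent Φ B ∧ (∀ s, x ∈ (B s).dom) ∧
      ∀ y, AgreeAt A y → AgreeAt B y := by
  by_cases hdom : ∃ s, x ∈ (A s).dom
  · obtain ⟨s, hs⟩ := hdom
    exact ⟨A, fun _ => le_rfl, h, fun s' => (hx s hs s').1, fun _ => id⟩
  · rw [not_exists] at hdom
    rcases x with ⟨κ, n⟩ | f
    exacts [h.exists_extend_class hr' hdom, h.exists_extend_fn hr' (hxΦ f rfl) hdom]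

theorem exists_extend_finite (hr' : Generic r') (h : Coherent Φ A) {X : Set (Pt r)}
    (hX : X.Finite) (hXΦ : Pt.fns X ⊆ Φ) (hXA : ∀ x ∈ X, AgreeAt A x) :
    ∃ B : S → PartialIso r r', (∀ s, A s ≤ B s) ∧ (∀ s, X ⊆ (B s).dom) ∧
      ∀ x ∈ X, AgreeAt B x := by
  suffices ∃ B : S → PartialIso r r', (∀ s, A s ≤ B s) ∧ Coherent Φ B ∧ (∀ s, X ⊆ (B s).dom) ∧
      ∀ y, AgreeAt A y → AgreeAt B y by
    obtain ⟨B, hAB, -, hdom, hB⟩ := this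
    exact ⟨B, hAB, hdom, fun x hx => hB x (hXA x hx)⟩
  induction X, hX using Set.Finite.induction_on with
  | empty => exact ⟨A, fun _ => le_rfl, h, fun _ => Set.empty_subset _, fun _ => id⟩
  | @insert x X _ _ ih =>
    obtain ⟨B, hAB, hB, hdom, hagree⟩ := ih (fun f hf => hXΦ (.inr hf)) fun y hy => hXA y (.inr hy)
    obtain ⟨C, hBC, hC, hx, hagree'⟩ := hB.exists_extend hr' (hagree x (hXA x (.inl rfl)))
      fun f hf => hXΦ (.inl hf.symm)
    exact ⟨C, fun s => (hAB s).trans (hBC s), hC,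
      fun s => Set.insert_subset (hx s) ((hdom s).trans (hBC s).1),
      fun y hy => hagree' y (hagree y hy)⟩

end Coherent

end PartialIso

end Coherence

/-! ### Independent amalgamation -/

section Independence

open Equiv Pt

variable {r : ℕ → ℕ → ℕ}

/-- `X` is independent from `D` over `C`: the substructure generated by `X` contains no point of `D`
outside `C`, and every class meeting both `X` and `D` meets `C`. -/
structure Independent (X C D : Set (Pt r)) : Prop where
  cl_inter_subset : cl X ∩ D ⊆ C
  classes_inter_subset : classes X ∩ classes D ⊆ classes C

namespace Independent

variable {C D X : Set (Pt r)}

theorem mono {C' D' : Set (Pt r)} (h : Independent X C D) (hC : C ⊆ C') (hD : D' ⊆ D) :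
    Independent X C' D' :=
  ⟨(Set.inter_subset_inter_right _ hD).trans (h.cl_inter_subset.trans hC),
    (Set.inter_subset_inter_right _ (classes_mono hD)).trans
      (h.classes_inter_subset.trans (classes_mono hC))⟩

variable {A : PartialIso r r}

theorem apply_eq_iff (h : Independent X C D) (hA : ∀ x ∈ C, A x = x) {x y : Pt r} (hx : x ∈ cl X)
    (hy : y ∈ D) (hAy : A y ∈ D) : A y = x ↔ y = x := by
  constructor
  · rintro rfl
    exact A.toEquiv.injective (hA _ (h.cl_inter_subset ⟨hx, hAy⟩)).symm
  · rintro rfl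
    exact hA y (h.cl_inter_subset ⟨hx, hy⟩)

theorem class_eq_of_apply_eq (h : Independent X C D) (hA : ∀ x ∈ C, A x = x) {κ κ' : ℕ}
    (hκ' : κ' ∈ classes X) (hAκ : A.τ κ ∈ classes D) (he : A.τ κ = κ') : κ = κ' := by
  obtain ⟨n, hn⟩ := h.classes_inter_subset ⟨hκ', he ▸ hAκ⟩
  exact A.τ.injective (he.trans (obj.inj (hA _ hn)).1.symm)

end Independent

namespace PartialIso

theorem exists_fixing (A : PartialIso r r) {P Q : Set (Pt r)} (hP : P.Finite) (hQ : Q.Finite)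
    (hτ : ∀ κ n, obj κ n ∈ P → A.τ κ = κ) (hPQ : ∀ x ∈ P, ∀ y ∈ Q, A y = x ↔ y = x) :
    ∃ h : ℕ → Perm ℕ, ∀ κ n, (obj κ n ∈ P → h κ n = n) ∧ (obj κ n ∈ Q → h κ n = A.h κ n) := by
  have hcross {κ n n' : ℕ} (hn : obj κ n ∈ P) (hn' : obj κ n' ∈ Q) : n = n' ↔ n = A.h κ n' := by
    simpa [hτ κ n hn, eq_comm] using (hPQ _ hn _ hn').symm
  have hperm (κ : ℕ) := exists_perm_of_finite
    (R := (fun n => (n, n)) '' {n | obj κ n ∈ P} ∪ (fun n => (n, A.h κ n)) '' {n | obj κ n ∈ Q})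
    (((hP.preimage fun _ _ _ _ h => (obj.inj h).2).image _).union
      ((hQ.preimage fun _ _ _ _ h => (obj.inj h).2).image _))
    (by
      rintro _ (⟨n, hn, rfl⟩ | ⟨n, hn, rfl⟩) _ (⟨n', hn', rfl⟩ | ⟨n', hn', rfl⟩)
      · rfl
      · exact hcross hn hn'
      · exact eq_comm.trans ((hcross hn' hn).trans eq_comm)
      · exact (A.h κ).injective.eq_iff.symm)
  choose h hh using hperm
  exact ⟨h, fun κ n => ⟨fun hn => hh κ (n, n) (.inl ⟨n, hn, rfl⟩),
    fun hn => hh κ (n, A.h κ n) (.inr ⟨n, hn, rfl⟩)⟩⟩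

/-- The identity on the points with functions in `Φ` and classes in `K`. -/
def refl {Φ K : Set ℕ} (hΦ : Φ.Finite) (hK : K.Finite) : PartialIso r r where
  σ := Equiv.refl ℕ
  τ := Equiv.refl ℕ
  h _ := Equiv.refl ℕ
  fns := Φ
  classes := K
  finite_fns := hΦ
  finite_classes := hK
  map_value _ _ _ _ := rfl

theorem refl_apply {Φ K : Set ℕ} (hΦ : Φ.Finite) (hK : K.Finite) (x : Pt r) :
    refl hΦ hK x = x := by
  cases x <;> rfl

end PartialIso

section Amalgam

variable {C D X : Set (Pt r)} (hC : C.Finite) (hX : X.Finite) (hXD : Independent X C D)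
include hC hX hXD

theorem exists_partialIso_fixing {ι : Type*} [Finite ι] {a a' : ι → Pt r}
    (htype : atomicType (Sum.elim ((↑) : C → Pt r) a) = atomicType (Sum.elim (↑) a'))
    (hD : cl (C ∪ (Set.range a ∪ Set.range a')) ⊆ D) :
    ∃ A : PartialIso r r, A.fns = fns (C ∪ Set.range a) ∧ A.classes = classes (C ∪ Set.range a) ∧
      (∀ x ∈ C, A x = x) ∧ A.Maps a a' ∧
      ∀ κ ∈ classes C, ∀ n, obj κ n ∈ cl X → A.h κ n = n := by
  have : Finite C := hC
  obtain ⟨A, hfns, hclasses, hA⟩ := exists_partialIso htype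
  simp only [Set.Sum.elim_range, Subtype.range_coe_subtype, Set.ofPred_mem_eq] at hfns hclasses
  have hfix (x : Pt r) (hx : x ∈ C) : A x = x := (hA (.inl ⟨x, hx⟩)).2
  have hmap : A.Maps a a' := fun l => hA (.inr l)
  have hAD (x : Pt r) (hx : x ∈ C ∪ Set.range a) :
      x ∈ A.dom ∧ A x ∈ C ∪ (Set.range a ∪ Set.range a') := by
    rcases hx with hx | ⟨l, rfl⟩
    · exact ⟨(hA (.inl ⟨x, hx⟩)).1, .inl ((hfix x hx).symm ▸ hx)⟩
    · exact ⟨(hmap l).1, .inr (.inr ⟨l, (hmap l).2.symm⟩)⟩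
  have hYD : cl (C ∪ Set.range a) ⊆ D :=
    (Set.image2_subset (Set.union_subset_union_right _ Set.subset_union_left)
      (Set.union_subset_union_right _ Set.subset_union_left)).trans hD
  have hAcl (y : Pt r) (hy : y ∈ cl (C ∪ Set.range a)) : A y ∈ D := by
    obtain ⟨u, hu, v, hv, rfl⟩ := hy
    rw [A.map_eval (hAD u hu).1 (hAD v hv).1]
    exact hD ⟨_, (hAD u hu).2, _, (hAD v hv).2, rfl⟩
  obtain ⟨h, hh⟩ := A.exists_fixing (P := {x ∈ cl X | classOf x ∈ classes C})
    (Q := cl (C ∪ Set.range a)) ((finite_cl hX).subset (Set.sep_subset _ _))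
    (finite_cl (hC.union (Set.finite_range a)))
    (fun κ n hκ => have ⟨_, hm⟩ := hκ.2; (obj.inj (hfix _ hm)).1)
    fun x hx y hy => hXD.apply_eq_iff hfix hx.1 (hYD hy) (hAcl y hy)
  let B : PartialIso r r := A.replaceMaps h fun f hf κ hκ =>
    (hh κ _).2 (value_mem_cl (hfns ▸ hf) (hclasses ▸ hκ))
  have hB (x : Pt r) (hx : x ∈ C ∪ Set.range a) : B x = A x := by
    rcases x with ⟨κ, n⟩ | f
    · exact congrArg (obj (A.τ κ)) ((hh κ n).2 (subset_cl _ hx))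
    · rfl
  exact ⟨B, hfns, hclasses, fun x hx => (hB x (.inl hx)).trans (hfix x hx),
    fun l => ⟨(hmap l).1, (hB _ (.inr ⟨l, rfl⟩)).trans (hmap l).2⟩,
    fun κ hκ n hn => (hh κ n).1 ⟨hn, hκ⟩⟩

end Amalgam

end Independence

section Amalgamation

open Pt

variable {r : ℕ → ℕ → ℕ} {C D X : Set (Pt r)}

theorem Independent.coherent (hXD : Independent X C D) {A : PartialIso r r} {Y Z : Set (Pt r)}
    (hfns : A.fns = fns Y) (hclasses : A.classes = classes Y) (hY : ∀ y ∈ Y, y ∈ D ∧ A y ∈ D)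
    (hA : ∀ x ∈ C, A x = x) (hAX : ∀ κ ∈ classes C, ∀ n, obj κ n ∈ cl X → A.h κ n = n)
    (hZX : Z ⊆ X) (hΦ : (fns (C ∪ Z)).Finite) (hK : (classes X ∩ classes (C ∪ Z)).Finite) :
    PartialIso.Coherent (fns X) fun b : Bool => if b then A else PartialIso.refl hΦ hK := by
  have hfn {f f' : ℕ} (hf : f ∈ A.fns) (hf' : f' ∈ fns (C ∪ Z)) (he : A.σ f = f') : f = f' := by
    rw [hfns] at hf
    have he' : A (fn f) = fn f' := congrArg fn he
    refine fn.inj (r := r) (hf'.elim (fun hC => ?_) fun hZ => ?_)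
    · exact A.toEquiv.injective (he'.trans (hA _ hC).symm)
    · exact (hXD.apply_eq_iff hA (subset_cl X (hZX hZ)) (hY _ hf).1 (hY _ hf).2).1 he'
  have hvalue {κ κ' : ℕ} (hκ : κ ∈ A.classes) (hκ' : κ' ∈ classes X) (he : A.τ κ = κ')
      {f : ℕ} (hf : f ∈ fns X) : A.h κ (r f κ) = r f κ' := by
    obtain ⟨n, hn⟩ := hclasses ▸ hκ
    obtain rfl := hXD.class_eq_of_apply_eq hA hκ' ⟨_, (hY _ hn).2⟩ he
    exact hAX κ (hXD.classes_inter_subset ⟨hκ', n, (hY _ hn).1⟩) _ (value_mem_cl hf hκ')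
  constructor
  · rintro (_ | _) f hf (_ | _) f' hf' he
    · exact he
    · exact (hfn hf' hf he.symm).symm
    · exact hfn hf hf' he
    · exact A.σ.injective he
  · rintro (_ | _) κ hκ (_ | _) κ' hκ' he f hf
    · exact congrArg (r f) he
    · exact (hvalue hκ' hκ.1 he.symm hf).symm
    · exact hvalue hκ hκ'.1 he hf
    · rw [A.τ.injective he]

theorem Independent.agreeAt (hXD : Independent X C D) {A : PartialIso r r} {Y Z E : Set (Pt r)}
    (hfns : A.fns = fns Y) (hclasses : A.classes = classes Y) (hYD : Y ⊆ D) (hCY : C ⊆ Y)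
    (hA : ∀ x ∈ C, A x = x) (hAX : ∀ κ ∈ classes C, ∀ n, obj κ n ∈ cl X → A.h κ n = n)
    (hEX : E ⊆ X) (hE : Independent E C Z) (hΦ : (fns (C ∪ Z)).Finite)
    (hK : (classes X ∩ classes (C ∪ Z)).Finite) {x : Pt r} (hx : x ∈ E) :
    PartialIso.AgreeAt (fun b : Bool => if b then A else PartialIso.refl hΦ hK) x := by
  suffices (x ∈ A.dom ↔ x ∈ (PartialIso.refl hΦ hK : PartialIso r r).dom) ∧
      (x ∈ A.dom → A x = x) by
    rintro (_ | _) hb (_ | _) <;> simp_all [PartialIso.refl_apply]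
  rcases x with ⟨κ, n⟩ | f
  · have hκX : κ ∈ classes X := mem_classes (hEX hx)
    have hκA : κ ∈ A.classes ↔ κ ∈ classes C := hclasses ▸
      ⟨fun h => hXD.classes_inter_subset ⟨hκX, classes_mono hYD h⟩, fun h => classes_mono hCY h⟩
    have hκI : κ ∈ classes (C ∪ Z) ↔ κ ∈ classes C := by
      refine ⟨fun ⟨m, hm⟩ => hm.elim mem_classes fun hmZ => ?_, fun h => classes_mono (by simp) h⟩
      exact hE.classes_inter_subset ⟨mem_classes hx, mem_classes hmZ⟩
    refine ⟨hκA.trans (hκI.symm.trans (and_iff_right hκX).symm), fun h => ?_⟩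
    obtain ⟨m, hm⟩ := hκA.1 h
    rw [ReductIso.toEquiv_obj, (obj.inj (hA _ hm)).1,
      hAX κ (mem_classes hm) n (subset_cl X (hEX hx))]
  · have hfA : f ∈ A.fns ↔ fn f ∈ C := hfns ▸
      ⟨fun h => hXD.cl_inter_subset ⟨subset_cl X (hEX hx), hYD h⟩, fun h => hCY h⟩
    have hfI : fn f ∈ C ∪ Z ↔ fn f ∈ C :=
      ⟨fun h => h.elim id fun hZ => hE.cl_inter_subset ⟨subset_cl E hx, hZ⟩, .inl⟩
    exact ⟨hfA.trans hfI.symm, fun h => hA _ (hfA.1 h)⟩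

/-- The amalgam `e'` is the common image of `e` under simultaneous extensions of a partial
isomorphism that maps `a` to `a'` and of the identity on `c`. -/
theorem Generic.exists_independent_amalgam (hr : Generic r) {m n : ℕ} {a a' c : Fin n → Pt r}
    {e : Fin m → Pt r} (hC : C.Finite)
    (htype : atomicType (Sum.elim ((↑) : C → Pt r) a) = atomicType (Sum.elim (↑) a'))
    (hXD : Independent (Set.range c ∪ Set.range e) C (cl (C ∪ (Set.range a ∪ Set.range a'))))
    (hE : Independent (Set.range e) C (Set.range c)) :
    ∃ e' : Fin m → Pt r, ∀ φ : L₁.Formula (Fin m ⊕ Fin n),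
      (φ.Realize (Sum.elim e a) ↔ φ.Realize (Sum.elim e' a')) ∧
        (φ.Realize (Sum.elim e c) ↔ φ.Realize (Sum.elim e' c)) := by
  have hX := (Set.finite_range c).union (Set.finite_range e)
  obtain ⟨A, hfns, hclasses, hA, haa', hAX⟩ :=
    exists_partialIso_fixing hC hX hXD htype subset_rfl
  have hY (y : Pt r) (hy : y ∈ C ∪ Set.range a) :
      y ∈ C ∪ (Set.range a ∪ Set.range a') ∧ A y ∈ C ∪ (Set.range a ∪ Set.range a') := by
    rcases hy with hy | ⟨l, rfl⟩
    · exact ⟨.inl hy, .inl ((hA y hy).symm ▸ hy)⟩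
    · exact ⟨.inr (.inl ⟨l, rfl⟩), .inr (.inr ⟨l, (haa' l).2.symm⟩)⟩
  have hYD := fun y hy => And.imp (fun h => subset_cl _ h) (fun h => subset_cl _ h) (hY y hy)
  have hΦ : (fns (C ∪ Set.range c)).Finite := finite_fns (hC.union (Set.finite_range c))
  have hK := (finite_classes hX).inter_of_left (classes (C ∪ Set.range c))
  have hcc : (PartialIso.refl hΦ hK : PartialIso r r).Maps c c := fun l => by
    refine ⟨?_, PartialIso.refl_apply hΦ hK _⟩
    rcases hl : c l with ⟨κ, k⟩ | f
    · exact ⟨mem_classes (.inl ⟨l, hl⟩), mem_classes (.inr ⟨l, hl⟩)⟩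
    · exact .inr ⟨l, hl⟩
  obtain ⟨B, hAB, hdom, hB⟩ :=
    (hXD.coherent hfns hclasses hYD hA hAX Set.subset_union_left hΦ hK).exists_extend_finite hr
      (Set.finite_range e) (fun f hf => .inr hf) fun x hx =>
        hXD.agreeAt hfns hclasses (fun y hy => (hYD y hy).1) Set.subset_union_left hA hAX
          Set.subset_union_right hE hΦ hK hx
  have he (b : Bool) : (B b).Maps e (B true ∘ e) := fun i =>
    ⟨hdom b ⟨i, rfl⟩, (hB _ ⟨i, rfl⟩ true (hdom true ⟨i, rfl⟩) b).2⟩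
  exact ⟨B true ∘ e, fun φ => ⟨((he true).elim (haa'.mono (hAB true))).realize_iff hr hr φ,
    ((he false).elim (hcc.mono (hAB false))).realize_iff hr hr φ⟩⟩

end Amalgamation

/-! ### The property NSOP₁ -/

section NSOP1

open Pt TreeProperties

variable {r : ℕ → ℕ → ℕ}

section Rank

variable {X C D : Set (Pt r)}

/-- The number of points of the substructure generated by `X` that lie in `C`, plus the number of
classes that meet both `X` and `C`.  It does not change when `C` is enlarged to `D` only if `X` is
independent from `D` over `C`. -/
noncomputable def rank (X C : Set (Pt r)) : ℕ :=
  (cl X ∩ C).ncard + (classes X ∩ classes C).ncard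

theorem rank_mono (hX : X.Finite) (h : C ⊆ D) : rank X C ≤ rank X D :=
  add_le_add
    (Set.ncard_le_ncard (Set.inter_subset_inter_right _ h) ((finite_cl hX).inter_of_left _))
    (Set.ncard_le_ncard (Set.inter_subset_inter_right _ (classes_mono h))
      ((finite_classes hX).inter_of_left _))

theorem rank_le (hX : X.Finite) {k : ℕ} (hk : X.ncard ≤ k) : rank X C ≤ k * k + k := by
  have hcl : (cl X).ncard ≤ k * k := by
    rw [cl, ← Set.image_uncurry_prod]
    exact (Set.ncard_image_le (hX.prod hX)).trans (Set.ncard_prod.trans_le (Nat.mul_le_mul hk hk))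
  have hsub : classes X ⊆ classOf '' X := fun _ ⟨_, hn⟩ => ⟨_, hn, rfl⟩
  have hclasses : (classes X).ncard ≤ k :=
    (Set.ncard_le_ncard hsub (hX.image classOf)).trans ((Set.ncard_image_le hX).trans hk)
  exact add_le_add ((Set.ncard_le_ncard Set.inter_subset_left (finite_cl hX)).trans hcl)
    ((Set.ncard_le_ncard Set.inter_subset_left (finite_classes hX)).trans hclasses)

theorem independent_of_rank_eq (hX : X.Finite) (h : C ⊆ D) (hrank : rank X C = rank X D) :
    Independent X C D := by
  have hcl := Set.inter_subset_inter_right (cl X) h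
  have hclasses := Set.inter_subset_inter_right (classes X) (classes_mono h)
  have hfin : (cl X ∩ D).Finite := (finite_cl hX).inter_of_left _
  have hfin' : (classes X ∩ classes D).Finite := (finite_classes hX).inter_of_left _
  obtain ⟨h₁, h₂⟩ := (add_eq_add_iff_eq_and_eq (Set.ncard_le_ncard hcl hfin)
    (Set.ncard_le_ncard hclasses hfin')).1 hrank
  exact ⟨(Set.eq_of_subset_of_ncard_le hcl h₁.ge hfin).ge.trans Set.inter_subset_right,
    (Set.eq_of_subset_of_ncard_le hclasses h₂.ge hfin').ge.trans Set.inter_subset_right⟩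

theorem exists_eq_succ_of_bounded {f : ℕ → ℕ} {b : ℕ} (hf : Monotone f) (hb : ∀ s, f s ≤ b) :
    ∃ s ≤ b, f s = f (s + 1) := by
  by_contra! h
  have hlt (s : ℕ) (hs : s ≤ b) : f s < f (s + 1) := (hf (Nat.le_succ s)).lt_of_ne (h s hs)
  have hle (s : ℕ) (hs : s ≤ b + 1) : s ≤ f s := by
    induction s with
    | zero => exact Nat.zero_le _
    | succ s ih => exact (ih (by omega)).trans_lt (hlt s (by omega))
  exact absurd (hb (b + 1)) (Nat.not_le.2 (hle (b + 1) le_rfl))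

theorem ncard_range_le {m : ℕ} (e : Fin m → Pt r) : (Set.range e).ncard ≤ m := by
  rw [← Set.image_univ]
  exact (Set.ncard_image_le Set.finite_univ).trans (by simp)

/-- The sequence `C` is cut into blocks longer than the ranks that occur: the rank of `e` is
constant on some block, and, if `c j` lies at its end, the rank of `c j, e` is constant on some step
of this block. -/
theorem exists_independent_pair (m n : ℕ) : ∃ N, ∀ C : ℕ → Set (Pt r), Monotone C →
    ∀ c : ℕ → Fin n → Pt r, (∀ j, Set.range (c j) ⊆ C j) → ∀ e : Fin m → Pt r,
      ∃ i j, i < j ∧ j ≤ N ∧ Independent (Set.range (c j) ∪ Set.range e) (C i) (C (i + 1)) ∧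
        Independent (Set.range e) (C i) (Set.range (c j)) := by
  let b := (n + m) * (n + m) + (n + m)
  refine ⟨(b + 1) * (b + 1), fun C hC c hc e => ?_⟩
  have he := Set.finite_range e
  obtain ⟨s, hs, hrank⟩ := exists_eq_succ_of_bounded
    (f := fun s => rank (Set.range e) (C ((b + 1) * s))) (b := b)
    (fun s t hst => rank_mono he (hC (Nat.mul_le_mul_left _ hst)))
    fun s => rank_le he ((ncard_range_le e).trans (Nat.le_add_left _ _))
  have hblock := independent_of_rank_eq he (hC (Nat.mul_le_mul_left _ (Nat.le_succ s))) hrank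
  have hX := (Set.finite_range (c ((b + 1) * (s + 1)))).union he
  obtain ⟨u, hu, hrank'⟩ := exists_eq_succ_of_bounded
    (f := fun u => rank (Set.range (c ((b + 1) * (s + 1))) ∪ Set.range e) (C ((b + 1) * s + u)))
    (b := b) (fun u v huv => rank_mono hX (hC (Nat.add_le_add_left huv _)))
    fun u => rank_le hX ((Set.ncard_union_le _ _).trans
      (add_le_add (ncard_range_le _) (ncard_range_le _)))
  refine ⟨(b + 1) * s + u, (b + 1) * (s + 1), by rw [mul_add]; omega,
    Nat.mul_le_mul_left _ (by omega),
    independent_of_rank_eq hX (hC (Nat.le_succ _)) hrank',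
    hblock.mono (hC (Nat.le_add_right _ _)) (hc _)⟩

end Rank

theorem exists_branching {n : ℕ} (a : List Bool → Fin n → Pt r) {C : Set (Pt r)} (hC : C.Finite)
    (ρ : List Bool) : ∃ η ν : List Bool, ρ <+: η ∧ η ++ [false] <+: ν ∧
      atomicType (Sum.elim ((↑) : C → Pt r) (a ν)) =
        atomicType (Sum.elim (↑) (a (η ++ [true]))) := by
  have : Finite C := hC
  obtain ⟨j, j', hne, he⟩ := Finite.exists_ne_map_eq_of_infinite fun j : ℕ =>
    atomicType (Sum.elim ((↑) : C → Pt r) (a (ρ ++ List.replicate j false ++ [true])))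
  wlog h : j < j' generalizing j j'
  · exact this j' j hne.symm he.symm (by omega)
  refine ⟨ρ ++ List.replicate j false, ρ ++ List.replicate j' false ++ [true],
    List.prefix_append _ _, ?_, he.symm⟩
  obtain ⟨d, rfl⟩ : ∃ d, j' = j + 1 + d := Nat.exists_eq_add_of_le h
  exact ⟨List.replicate d false ++ [true], by simp [List.replicate_add]⟩

theorem exists_branching_sequence {n : ℕ} (a : List Bool → Fin n → Pt r) :
    ∃ (C : ℕ → Set (Pt r)) (ρ η : ℕ → List Bool), (∀ i, (C i).Finite) ∧
      (∀ i, Set.range (a (ρ i)) ⊆ C i) ∧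
      (∀ i, cl (C i ∪ (Set.range (a (ρ (i + 1))) ∪ Set.range (a (η i ++ [true])))) ⊆ C (i + 1)) ∧
      (∀ i, ρ i <+: η i ∧ η i ++ [false] <+: ρ (i + 1)) ∧
      ∀ i, atomicType (Sum.elim ((↑) : C i → Pt r) (a (ρ (i + 1)))) =
        atomicType (Sum.elim (↑) (a (η i ++ [true]))) := by
  choose η ν hη hν htype using fun p : {C : Set (Pt r) // C.Finite} × List Bool =>
    exists_branching a p.1.2 p.2
  let step (p : {C : Set (Pt r) // C.Finite} × List Bool) :
      {C : Set (Pt r) // C.Finite} × List Bool :=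
    (⟨cl (p.1 ∪ (Set.range (a (ν p)) ∪ Set.range (a (η p ++ [true])))),
      finite_cl (p.1.2.union ((Set.finite_range _).union (Set.finite_range _)))⟩, ν p)
  let st (i : ℕ) : {C : Set (Pt r) // C.Finite} × List Bool :=
    i.rec (⟨Set.range (a []), Set.finite_range _⟩, []) fun _ => step
  refine ⟨fun i => (st i).1, fun i => (st i).2, fun i => η (st i), fun i => (st i).1.2, ?_,
    fun i => subset_rfl, fun i => ⟨hη (st i), hν (st i)⟩, fun i => htype (st i)⟩
  rintro (_ | i)
  · exact subset_rfl
  · exact (Set.subset_union_left.trans Set.subset_union_right).trans (subset_cl _)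

theorem Generic.exists_mem_inter_solutions (hr : Generic r) {m n : ℕ}
    (φ : L₁.Formula (Fin m ⊕ Fin n)) (a : List Bool → Fin n → Pt r)
    (hcons : ∀ ν, ∃ x, ∀ μ, μ <+: ν → x ∈ solutions φ (a μ)) :
    ∃ η ν : List Bool, η ++ [false] <+: ν ∧
      (solutions φ (a ν) ∩ solutions φ (a (η ++ [true]))).Nonempty := by
  obtain ⟨C, ρ, η, hfin, hρC, hcl, hρη, htype⟩ := exists_branching_sequence a
  have hC : Monotone C := monotone_nat_of_le_succ fun i =>
    (Set.subset_union_left.trans (subset_cl _)).trans (hcl i)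
  have hρ ⦃i j : ℕ⦄ (hij : i ≤ j) : ρ i <+: ρ j :=
    Nat.rel_of_forall_rel_succ_of_le (· <+: ·)
      (fun i => (hρη i).1.trans ((List.prefix_append _ _).trans (hρη i).2)) hij
  obtain ⟨N, hN⟩ := exists_independent_pair (r := r) m n
  obtain ⟨e, he⟩ := hcons (ρ N)
  obtain ⟨i, j, hij, hjN, hX, hE⟩ := hN C hC (fun j => a (ρ j)) hρC e
  obtain ⟨e', he'⟩ := hr.exists_independent_amalgam (hfin i) (htype i)
    (hX.mono subset_rfl (hcl i)) hE
  exact ⟨η i, ρ j, (hρη i).2.trans (hρ hij), e', (he' φ).2.1 (he _ (hρ hjN)),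
    (he' φ).1.1 (he _ (hρ (hij.trans_le hjN)))⟩

end NSOP1

/-! ### The type of an object -/

section ObjectType

open Pt TreeProperties

variable {r : ℕ → ℕ → ℕ}

theorem Generic.exists_elementaryEmbedding_pair (hr : Generic r) {N : Type} [L₁.Structure N]
    [N ⊨ L₁.completeTheory (Pt r)] {I : Type} [Countable I] {m n : ℕ} (x : I → Fin m → N)
    (a : I → Fin n → N) :
    ∃ (g : Pt r ↪ₑ[L₁] N) (x' : I → Fin m → Pt r) (a' : I → Fin n → Pt r),
      (∀ i, g ∘ x' i = x i) ∧ ∀ i, g ∘ a' i = a i := by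
  obtain ⟨g, w, hw⟩ := hr.exists_elementaryEmbedding fun p : I × (Fin m ⊕ Fin n) =>
    Sum.elim (x p.1) (a p.1) p.2
  exact ⟨g, fun i l => w (i, .inl l), fun i l => w (i, .inr l),
    fun i => funext fun l => congrFun hw (i, .inl l),
    fun i => funext fun l => congrFun hw (i, .inr l)⟩

theorem Generic.nsop1 (hr : Generic r) : NSOP1 (L₁.completeTheory (Pt r)) := by
  rintro m n φ ⟨N, a, hcons, hinc⟩
  choose x hx using exists_mem_of_prefix (D := fun ν => solutions φ (a ν)) false hcons
  obtain ⟨g, x', a', hx', ha'⟩ := hr.exists_elementaryEmbedding_pair x a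
  obtain ⟨η, ν, hην, y, hy, hy'⟩ := hr.exists_mem_inter_solutions φ a' fun ν =>
    ⟨x' ν, fun μ hμ => (comp_mem_solutions_iff g).1 (by simpa only [hx', ha'] using hx ν μ hμ)⟩
  refine hinc η ν hην ⟨g ∘ y, ?_, ?_⟩ <;> rw [← ha', comp_mem_solutions_iff] <;> assumption

/-- The complete type of an object, isolated by `O(x)`. -/
noncomputable def objectType (r : ℕ → ℕ → ℕ) : (L₁.completeTheory (Pt r)).CompleteType (Fin 1) :=
  (L₁.completeTheory (Pt r)).typeOf fun _ => (obj 0 0 : Pt r)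

theorem mem_formulasOf_objectType {ψ : L₁.Formula (Fin 1)} :
    ψ ∈ formulasOf (objectType r) ↔ ψ.Realize fun _ => (obj 0 0 : Pt r) :=
  Theory.CompleteType.formula_mem_typeOf (T := L₁.completeTheory (Pt r))

theorem realize_formulaO {M : Type*} [L₁.Structure M] (v : Fin 1 → M) :
    formulaO.Realize v ↔ O (v 0) :=
  BoundedFormula.realize_rel₁

theorem Generic.realize_of_mem_objectType (hr : Generic r) {ψ : L₁.Formula (Fin 1)}
    (hψ : ψ ∈ formulasOf (objectType r)) {v : Fin 1 → Pt r} (hv : O (v 0)) : ψ.Realize v := by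
  obtain ⟨κ, n, h⟩ := exists_eq_obj hv
  have htype : atomicType (fun _ : Fin 1 => (obj 0 0 : Pt r)) = atomicType v :=
    atomicType_eq_iff.2 (by simp [Fin.forall_fin_one, h])
  obtain ⟨A, -, -, hA⟩ := exists_partialIso htype
  exact (hA.realize_iff hr hr ψ).1 (mem_formulasOf_objectType.1 hψ)

theorem Generic.axiomatizes (hr : Generic r) :
    Axiomatizes (L₁.completeTheory (Pt r)) formulaO (objectType r) := by
  refine ⟨mem_formulasOf_objectType.2 ((realize_formulaO _).2 (O_obj 0 0)), fun ψ hψ => ?_⟩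
  rw [Theory.models_formula_iff]
  intro N v
  exact realize_of_completeTheory (M := Pt r) (formulaO.imp ψ) (fun v => Formula.realize_imp.2
    fun h => hr.realize_of_mem_objectType hψ ((realize_formulaO v).1 h)) v

theorem exists_O_mem_of_prefix {M A : Type} [L₁.Structure M] (d : A) {π : Set (L₁.Formula (Fin 1))}
    (hO : formulaO ∈ π) {D : List A → Set (Fin 1 → M)}
    (h : ∀ η : ℕ → A, Consistent (Sum.elim (fun ψ : π => {x : Fin 1 → M | ψ.1.Realize x})
      fun i : ℕ => D (restrict η i))) (ν : List A) :
    ∃ x, O (x 0) ∧ ∀ μ, μ <+: ν → x ∈ D μ := by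
  have hcons (η : ℕ → A) : Consistent fun i : ℕ => {x | O (x 0)} ∩ D (restrict η i) := by
    intro s
    obtain ⟨x, hx⟩ := h η (({⟨formulaO, hO⟩} : Finset π).disjSum s)
    rw [Set.mem_iInter₂] at hx
    exact ⟨x, Set.mem_iInter₂.2 fun i hi => ⟨(realize_formulaO x).1 (hx (.inl ⟨formulaO, hO⟩)
      (by simp)), hx (.inr i) (by simpa using hi)⟩⟩
  obtain ⟨x, hx⟩ := exists_mem_of_prefix (D := fun ν => {x : Fin 1 → M | O (x 0)} ∩ D ν) d hcons ν
  exact ⟨x, (hx ν List.prefix_rfl).1, fun μ hμ => (hx μ hμ).2⟩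

theorem Generic.isSimpleType (hr : Generic r) :
    IsSimpleType (L₁.completeTheory (Pt r)) (formulasOf (objectType r)) := by
  rintro ⟨n, φ, k, N, a, hk, hcons⟩
  choose x hO hx using exists_O_mem_of_prefix (D := fun ν => solutions φ (a ν)) 0
    hr.axiomatizes.1 hcons
  obtain ⟨g, x', a', hx', ha'⟩ := hr.exists_elementaryEmbedding_pair x a
  have hsol (ν : List ℕ) : solutions φ (a' ν) = (g ∘ ·) ⁻¹' solutions φ (a ν) := by
    ext y
    rw [Set.mem_preimage, ← ha', comp_mem_solutions_iff]
  have hk' (η : List ℕ) : KInconsistent k fun i : ℕ => solutions φ (a' (η ++ [i])) := by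
    simp only [hsol]
    exact (hk η).preimage (g ∘ ·)
  obtain ⟨η, hη⟩ := hr.not_treeProperty φ a' hk'
  have hO' : O (x' η 0) := by
    rw [← O_map_embedding g.toEmbedding]
    exact (congrArg (fun y => O (y 0)) (hx' η)).mpr (hO η)
  obtain ⟨μ, hμ, hμx⟩ := hη (x' η) hO'
  rw [hsol, Set.mem_preimage, hx'] at hμx
  exact hμx (hx η μ hμ)

/-- The formula `F(x) ∧ eval(x, y) = y`, which has the tree property with objects `y`: a function
selects only one element of each class, but elements of distinct classes independently. -/
noncomputable def selects : L₁.Formula (Fin 1 ⊕ Fin 1) :=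
  isF (Term.var (.inl (.inl 0))) ⊓
    Term.bdEqual (evalT (Term.var (.inl (.inl 0))) (Term.var (.inl (.inr 0))))
      (Term.var (.inl (.inr 0)))

theorem mem_solutions_selects {M : Type*} [L₁.Structure M] {x y : Fin 1 → M} :
    x ∈ solutions selects y ↔ F (x 0) ∧ eval (x 0) (y 0) = y 0 := by
  rw [solutions, Set.mem_ofPred_eq, selects, Formula.realize_inf]
  refine Iff.and BoundedFormula.realize_rel₁ ((BoundedFormula.realize_bdEqual _ _).trans ?_)
  simp [evalT, eval]

theorem eq_of_mem_solutions_selects {M : Type*} [L₁.Structure M] (h : M ⊨ T₁) {x y y' : Fin 1 → M}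
    (hy : x ∈ solutions selects y) (hy' : x ∈ solutions selects y') (hE : E (y 0) (y' 0)) :
    y 0 = y' 0 := by
  obtain ⟨-, -, -, -, -, -, hcongr, -⟩ := (model_T₁_iff M).1 h
  rw [mem_solutions_selects] at hy hy'
  rw [← hy.2, ← hy'.2, hcongr _ _ _ hy.1 hE]

/-- The parameters of the tree showing that the type of an object is not co-simple: each level of
the tree has its own class, and the node `η ++ [i]` is the object with index `i` in it. -/
def treeNode (r : ℕ → ℕ → ℕ) (η : List ℕ) : Fin 1 → Pt r :=
  fun _ => obj η.length (η.getLast?.getD 0)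

theorem kInconsistent_selects (η : List ℕ) :
    KInconsistent 2 fun i : ℕ => solutions selects (treeNode r (η ++ [i])) := by
  rintro s hs ⟨x, hx⟩
  obtain ⟨i, j, hij, rfl⟩ := Finset.card_eq_two.1 hs
  rw [Set.mem_iInter₂] at hx
  have h := eq_of_mem_solutions_selects (model_T₁ r) (hx i (by simp)) (hx j (by simp))
    (by simp [treeNode])
  exact hij (by simpa [treeNode] using h)

theorem Generic.consistent_selects (hr : Generic r) (η : ℕ → ℕ) :
    Consistent fun i : ℕ => solutions selects (treeNode r (restrict η i)) := by
  intro s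
  obtain ⟨f, -, hf⟩ := hr.exists_fn Set.finite_empty s.finite_toSet
    fun i => (restrict η i).getLast?.getD 0
  refine ⟨fun _ => fn f, Set.mem_iInter₂.2 fun i hi => mem_solutions_selects.2 ⟨F_fn f, ?_⟩⟩
  have hlength : (restrict η i).length = i := by simp [restrict]
  rw [treeNode, hlength, eval_fn_obj, hf i hi]

theorem Generic.not_isCoSimpleType (hr : Generic r) :
    ¬ IsCoSimpleType (L₁.completeTheory (Pt r)) (formulasOf (objectType r)) :=
  not_not_intro ⟨1, selects, 2, Theory.ModelType.of _ (Pt r), treeNode r, kInconsistent_selects,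
    hr.consistent_selects, fun _ _ hψ => hr.realize_of_mem_objectType hψ (O_obj _ _)⟩

end ObjectType

end Selector

theorem corollary9p12 :
    (∃ (M : Type) (_ : Selector.L₁.Structure M) (_ : Countable M),
      IsFraisseLimit Selector.K₁ M) ∧
    ∀ (M : Type) [Selector.L₁.Structure M] [Countable M], IsFraisseLimit Selector.K₁ M →
      TreeProperties.NSOP1 (Selector.L₁.completeTheory M) ∧
      ∃ p : (Selector.L₁.completeTheory M).CompleteType (Fin 1),
        TreeProperties.Axiomatizes (Selector.L₁.completeTheory M) Selector.formulaO p ∧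
        TreeProperties.IsSimpleType (Selector.L₁.completeTheory M) (TreeProperties.formulasOf p) ∧
        ¬ TreeProperties.IsCoSimpleType (Selector.L₁.completeTheory M)
          (TreeProperties.formulasOf p) := by
  have hq := Selector.generic_explicitValue
  refine ⟨⟨Selector.Pt Selector.explicitValue, inferInstance, inferInstance, hq.isFraisseLimit⟩,
    fun M _ _ hM => ?_⟩
  obtain ⟨g⟩ := IsFraisseLimit.nonempty_equiv hM hq.isFraisseLimit
  have hT : Selector.L₁.completeTheory M =
      Selector.L₁.completeTheory (Selector.Pt Selector.explicitValue) :=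
    g.toElementaryEmbedding.elementarilyEquivalent.completeTheory_eq
  rw [hT]
  exact ⟨hq.nsop1, Selector.objectType _, hq.axiomatizes, hq.isSimpleType, hq.not_isCoSimpleType⟩
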